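/- A positional scoring rule $r$ assigns to every number $m \ge 1$ of candidates a vector of natural numbers $r(m,1) \ge r(m,2) \ge \dots \ge r(m,m)$, with $r(m,1) > r(m,m)$ if $m \ge 2$. Given $n$ linear orders $\mathbf{T} = (T_1,\dots,T_n)$ (the voters' rankings) on a set $C$ of $m$ candidates, the score of $c \in C$ is $s(\mathbf{T},c) = \sum_{i=1}^n r(m,j_i)$, where $j_i$ is the position of $c$ in $T_i$. Given also a linear order $\tau$ on $C$ (the tiebreaker), the rank of $c$ in $\mathbf{T}$ is the position of $c$ in the linear order that sorts the candidates by decreasing score, candidates with equal scores being sorted by $\tau$. For a partial profile $\mathbf{P} = (P_1,\dots,P_n)$ of partial orders on $C$, the maximal rank of $c$ is the maximum of its rank in $\mathbf{T}$ over all $\mathbf{T} = (T_1,\dots,T_n)$ such that every $T_i$ is a linear extension of $P_i$. **Theorem.** Let $k \ge 1$ be a fixed integer, and let $r$ be a fixed positional scoring rule such that $r(m,j)$ is computable in time polynomial in $m$ and is bounded by a polynomial in $m$. Then there is a polynomial-time algorithm (a deterministic Turing machine) that decides, given a partial profile $\mathbf{P}$, a tiebreaker $\tau$ and a candidate $c$,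 whether the maximal rank of $c$ is larger than $k$. -/

import Mathlib

noncomputable section

namespace RankVoting

/-- A positional scoring rule: `score m j` is the score `r(m, j)` that a voter gives to the
candidate in position `j` (positions are numbered from `1`, the most preferred one, to `m`) when
there are `m` candidates. The values outside `1 ≤ j ≤ m` are never used.
The requirement that the first score exceeds the last one makes sense for `m ≥ 2` only. -/
structure PositionalScoringRule where
  /-- the scores -/
  score : ℕ → ℕ → ℕ
  /-- the scores are nonincreasing along the positions -/
  antitone : ∀ m i j, 1 ≤ i → i ≤ j → j ≤ m → score m j ≤ score m i
  /-- the first score is larger than the last one -/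
  last_lt_first : ∀ m, 2 ≤ m → score m m < score m 1

/-- The arguments `(m, j)` of a scoring rule: a number of candidates and a position. -/
abbrev ScoreArg : Type := {p : ℕ × ℕ // 1 ≤ p.2 ∧ p.2 ≤ p.1}

/-- The word `1 ^ m 0 1 ^ j`. Its length is between `m` and `2 * m + 1`, so that polynomial time in
the length of this word is polynomial time in `m`. -/
def ScoreArg.encode (p : ScoreArg) : List Bool :=
  List.replicate p.1.1 true ++ false :: List.replicate p.1.2 true

/-- `r(m, j)` is computable (in binary) by a Turing machine in time polynomial in `m`. -/
def PositionalScoringRule.PolyTimeComputable (r : PositionalScoringRule) : Prop :=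
  Nonempty (Turing.TM2ComputableInPolyTime ScoreArg.encode Computability.encodeNat
    (fun p : ScoreArg => r.score p.1.1 p.1.2))

/-- The scores are bounded by a polynomial in the number of candidates. -/
def PositionalScoringRule.HasPolynomialScores (r : PositionalScoringRule) : Prop :=
  ∃ p : Polynomial ℕ, ∀ m j, 1 ≤ j → j ≤ m → r.score m j ≤ p.eval m

open scoped Classical in
/-- The position of `c` in a (reflexive) linear order `T` on the candidates, where `T a b` means
that `a` is `b` or is ranked above `b`. The top candidate has position `1`. -/
def position {m : ℕ} (T : Fin m → Fin m → Prop) (c : Fin m) : ℕ :=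
  (Finset.univ.filter fun d => T d c).card

/-- The score of the candidate `c` in the voting profile `T` of `n` voters. -/
def totalScore {m n : ℕ} (r : PositionalScoringRule) (T : Fin n → Fin m → Fin m → Prop)
    (c : Fin m) : ℕ :=
  ∑ i, r.score m (position (T i) c)

/-- The reflexive linear order that sorts the candidates by their scores in the profile `T`, and
then by the tiebreaker `tie`. -/
def resultOrder {m n : ℕ} (r : PositionalScoringRule) (T : Fin n → Fin m → Fin m → Prop)
    (tie : Fin m → Fin m → Prop) (a b : Fin m) : Prop :=
  totalScore r T b < totalScore r T a ∨ (totalScore r T a = totalScore r T b ∧ tie a b)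

/-- The rank of `c` in the voting profile `T` under the tiebreaker `tie`. -/
def rank {m n : ℕ} (r : PositionalScoringRule) (T : Fin n → Fin m → Fin m → Prop)
    (tie : Fin m → Fin m → Prop) (c : Fin m) : ℕ :=
  position (resultOrder r T tie) c

/-- `T` is a completion of the partial voting profile `P`: every `T i` is a linear extension of
`P i`. -/
def IsCompletion {m n : ℕ} (P T : Fin n → Fin m → Fin m → Prop) : Prop :=
  ∀ i, IsLinearOrder (Fin m) (T i) ∧ ∀ a b, P i a b → T i a b

/-- The ranks that `c` gets in the completions of the partial voting profile `P`. -/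
def ranks {m n : ℕ} (r : PositionalScoringRule) (P : Fin n → Fin m → Fin m → Prop)
    (tie : Fin m → Fin m → Prop) (c : Fin m) : Set ℕ :=
  {x | ∃ T, IsCompletion P T ∧ rank r T tie c = x}

/-- The maximal rank of `c` in the completions of the partial voting profile `P`. -/
def maxRank {m n : ℕ} (r : PositionalScoringRule) (P : Fin n → Fin m → Fin m → Prop)
    (tie : Fin m → Fin m → Prop) (c : Fin m) : ℕ :=
  sSup (ranks r P tie c)

/-- The maximal rank is a maximum: it is attained, and no completion exceeds it. -/
theorem isGreatest_maxRank {m n : ℕ} (r : PositionalScoringRule)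
    (P : Fin n → Fin m → Fin m → Prop) (hP : ∀ i, IsPartialOrder (Fin m) (P i))
    (tie : Fin m → Fin m → Prop) (c : Fin m) :
    IsGreatest (ranks r P tie c) (maxRank r P tie c) := by
  have hb : BddAbove (ranks r P tie c) := by
    refine ⟨m, ?_⟩
    rintro x ⟨T, -, rfl⟩
    unfold rank position
    exact (Finset.card_le_univ _).trans (Fintype.card_fin m).le
  have hne : (ranks r P tie c).Nonempty := by
    have h : ∀ i, ∃ T : Fin m → Fin m → Prop, IsLinearOrder (Fin m) T ∧ P i ≤ T := fun i =>
      haveI := hP i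
      extend_partialOrder (P i)
    choose T hT using h
    exact ⟨_, T, fun i => ⟨(hT i).1, fun a b hab => (hT i).2 a b hab⟩, rfl⟩
  exact ⟨Nat.sSup_mem hne hb, fun x hx => le_csSup hb hx⟩

/-- An input of the decision problem: a partial voting profile of `n` voters on `m` candidates, a
tiebreaker, and a candidate. -/
structure Instance where
  /-- the number of candidates -/
  m : ℕ
  /-- the number of voters -/
  n : ℕ
  /-- `profile i a b` means that voter `i` is known to prefer `a` to `b`, or that `a = b` -/
  profile : Fin n → Fin m → Fin m → Prop
  /-- every voter has a (reflexive) partial order -/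
  profile_isPartialOrder : ∀ i, IsPartialOrder (Fin m) (profile i)
  /-- the tiebreaker; `tie a b` means that `a` is placed above `b`, or that `a = b` -/
  tie : Fin m → Fin m → Prop
  /-- the tiebreaker is a (reflexive) linear order -/
  tie_isLinearOrder : IsLinearOrder (Fin m) tie
  /-- the candidate -/
  c : Fin m

open scoped Classical in
/-- The 0-1 matrix of a relation on the candidates, row by row. -/
def relationBits {m : ℕ} (R : Fin m → Fin m → Prop) : List Bool :=
  (List.finRange m).flatMap fun a => (List.finRange m).map fun b => decide (R a b)

/-- The encoding of an input as a binary word: `1 ^ m 0 1 ^ n 0 1 ^ c 0`, followed by the matrix of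
the tiebreaker and the matrices of the voters' partial orders. -/
def Instance.encode (I : Instance) : List Bool :=
  List.replicate I.m true ++ false :: (List.replicate I.n true ++ false ::
    (List.replicate (I.c : ℕ) true ++ false ::
      (relationBits I.tie ++ (List.finRange I.n).flatMap fun i => relationBits (I.profile i))))

open scoped Classical in
/-- The answer to the question whether the maximal rank of the given candidate exceeds `k`. -/
def Instance.maxRankExceeds (r : PositionalScoringRule) (k : ℕ) (I : Instance) : Bool :=
  decide (k < maxRank r I.profile I.tie I.c)

end RankVoting

end

/-!
The maximal rank of `c` exceeds `k` if and only if there are `k` other candidates, the rivals,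
that all beat `c` in one completion. As `k` is fixed, all `k`-tuples of rivals can be tried. For
fixed rivals `D`, two facts make the search for a completion feasible.

* *One voter.* Lowering `c` and raising the rivals only helps, so the exact positions may be
  replaced by bounds: `c` at position `q` or below and `D d` at position `p d` or above. Whether a
  partial order has such a linear extension is decided by counting (`RankVoting.Feasible`):
  certain candidates are confined to the intervals `[q, m]`, `[1, t]` and `[q, t]`, which must
  have room for them. Conversely, scheduling by earliest deadline shows that these conditions are
  sufficient (`RankVoting.Feasible.exists_linearOrder`). With `RankVoting.lt_maxRank_iff` the
  problem becomes one about vectors of `k + 1` positions, one vector for each voter, of which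
  there are polynomially many per voter.

* *All voters.* The scores of `c` and of the rivals are polynomially bounded, so there are only
  polynomially many vectors of `k + 1` total scores. Dynamic programming over the voters
  determines which of them are reachable (`RankVoting.bitAt_sumTable`); a vector of scores is
  stored as a single number, with the scores as its digits.

For the Turing machine, a small language of programs on binary stacks is compiled into machines of
type `Turing.FinTM2`, with subroutine calls of one given machine, here that of the scoring rule
(`StackProgram.Exec.steps`). `StackProgram.Poly` is the class of functions that such programs
compute in polynomial time. It is closed under composition, pairing, case distinction and
recursion with polynomially bounded intermediate results (`StackProgram.Poly.natRec`); `fun_prop`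
uses these closure properties to show that the decision procedure `RankVoting.answer` is in the
class.
-/

/-! ### Stack programs -/

namespace StackProgram

open Function Turing

/-- Structured programs that act on a family of binary stacks indexed by `V`. -/
inductive Prog (V : Type) : Type
  /-- do nothing -/
  | skip : Prog V
  /-- push a bit -/
  | push : V → Bool → Prog V
  /-- sequential composition -/
  | seq : Prog V → Prog V → Prog V
  /-- pop a bit and branch on it; the first branch is for the empty stack -/
  | case : V → Prog V → (Bool → Prog V) → Prog V
  /-- while the stack is nonempty, pop a bit and run the body for that bit -/
  | loop : V → (Bool → Prog V) → Prog V
  /-- empty the first stack into the input of the oracle, run the oracle, and empty its output onto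
  the second stack -/
  | call : V → V → Prog V

variable {V W : Type} [DecidableEq V] [DecidableEq W]

/-- The semantics of `Prog.call`: `run w t out` means that the oracle turns the word `w` into the
word `out` in `t` steps. -/
structure Oracle where
  /-- the runs of the oracle -/
  run : List Bool → ℕ → List Bool → Prop

/-- `Exec O p s t s'` means that `p`, started on the stacks `s`, stops after `t` steps with the
stacks `s'`. The number of steps is that of the compiled Turing machine. Moving a word from one
stack to another reverses it, which is where the two `reverse`s of `call` come from. -/
inductive Exec (O : Oracle) :
    Prog V → (V → List Bool) → ℕ → (V → List Bool) → Prop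
  | skip (s) : Exec O .skip s 1 s
  | push (v b s) : Exec O (.push v b) s 1 (update s v (b :: s v))
  | seq {p q s t s' t' s''} : Exec O p s t s' → Exec O q s' t' s'' →
      Exec O (.seq p q) s (t + t') s''
  | case_nil {v e p s t s'} : s v = [] → Exec O e s t s' → Exec O (.case v e p) s (1 + t) s'
  | case_cons {v e p s t s' b l} : s v = b :: l → Exec O (p b) (update s v l) t s' →
      Exec O (.case v e p) s (1 + t) s'
  | loop_nil {v p s} : s v = [] → Exec O (.loop v p) s 1 s
  | loop_cons {v p s t s' t' s'' b l} : s v = b :: l → Exec O (p b) (update s v l) t s' →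
      Exec O (.loop v p) s' t' s'' → Exec O (.loop v p) s (1 + t + t') s''
  | call {v w s t out} : O.run (s v).reverse t out →
      Exec O (.call v w) s ((s v).length + 1 + t + (out.length + 1))
        (update (update s v []) w (out.reverse ++ update s v [] w))

/-! ### Compilation of stack programs into Turing machines -/

section Compile

variable (tm : FinTM2) (inp : tm.Γ tm.k₀ ≃ Bool) (outp : tm.Γ tm.k₁ ≃ Bool)

/-- The labels of the machine code of a program: one for each instruction, and for a call also those
of the machine `tm` that is called. -/
def Lab : Prog V → Type
  | .skip => Unit
  | .push _ _ => Unit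
  | .seq p q => Lab p ⊕ Lab q
  | .case _ e p => Option (Lab e ⊕ Σ b, Lab (p b))
  | .loop _ p => Option (Σ b, Lab (p b))
  | .call _ _ => Bool ⊕ tm.Λ

/-- The labels of a program form a finite type. -/
@[reducible] def Lab.fintype : (p : Prog V) → Fintype (Lab tm p)
  | .skip => inferInstanceAs (Fintype Unit)
  | .push _ _ => inferInstanceAs (Fintype Unit)
  | .seq p q =>
    haveI := Lab.fintype p
    haveI := Lab.fintype q
    inferInstanceAs (Fintype (Lab tm p ⊕ Lab tm q))
  | .case _ e p =>
    haveI := Lab.fintype e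
    haveI := fun b => Lab.fintype (p b)
    inferInstanceAs (Fintype (Option (Lab tm e ⊕ Σ b, Lab tm (p b))))
  | .loop _ p =>
    haveI := fun b => Lab.fintype (p b)
    inferInstanceAs (Fintype (Option (Σ b, Lab tm (p b))))
  | .call _ _ =>
    haveI := tm.ΛFin
    inferInstanceAs (Fintype (Bool ⊕ tm.Λ))

/-- The label at which a program starts. -/
def entry : (p : Prog V) → Lab tm p
  | .skip => ()
  | .push _ _ => ()
  | .seq p _ => Sum.inl (entry p)
  | .case _ _ _ => none
  | .loop _ _ => none
  | .call _ _ => Sum.inl true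

/-- The stack alphabets of the compiled machine: bits for the stacks of the program, and the
alphabets of `tm` for its own stacks. -/
abbrev Alph (V : Type) : V ⊕ tm.K → Type
  | .inl _ => Bool
  | .inr k => tm.Γ k

/-- The internal memory of the compiled machine: the bit popped last, and the memory of `tm`. -/
abbrev Reg : Type := Option Bool × tm.σ

/-- The statements of the compiled machine. -/
abbrev Code (V Λ : Type) : Type := TM2.Stmt (Alph tm V) Λ (Reg tm)

/-- A statement of `tm` as a statement of the compiled machine. Where `tm` halts, control passes to
the label `exit`. -/
def liftStmt {Λ : Type} (emb : tm.Λ → Λ) (exit : Λ) :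
    TM2.Stmt tm.Γ tm.Λ tm.σ → Code tm V Λ
  | .push k f q => .push (Sum.inr k) (fun x => f x.2) (liftStmt emb exit q)
  | .peek k f q => .peek (Sum.inr k) (fun x o => (x.1, f x.2 o)) (liftStmt emb exit q)
  | .pop k f q => .pop (Sum.inr k) (fun x o => (x.1, f x.2 o)) (liftStmt emb exit q)
  | .load f q => .load (fun x => (x.1, f x.2)) (liftStmt emb exit q)
  | .branch f q q' => .branch (fun x => f x.2) (liftStmt emb exit q) (liftStmt emb exit q')
  | .goto l => .goto fun x => emb (l x.2)
  | .halt => .goto fun _ => exit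

/-- The machine code of a program, in continuation-passing style: `emb` places the labels of the
program among those of the whole machine, and control passes to `exit` when the program stops. -/
def code {Λ : Type} : (p : Prog V) → (Lab tm p → Λ) → Λ → Lab tm p → Code tm V Λ
  | .skip, _, exit, _ => .goto fun _ => exit
  | .push v b, _, exit, _ => .push (Sum.inl v) (fun _ => b) (.goto fun _ => exit)
  | .seq p q, emb, exit, l => match l with
    | .inl l => code p (fun l => emb (.inl l)) (emb (.inr (entry tm q))) l
    | .inr l => code q (fun l => emb (.inr l)) exit l
  | .case v e p, emb, exit, l => match l with
    | none => .pop (Sum.inl v) (fun x o => (o, x.2)) (.goto fun x => match x.1 with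
        | none => emb (some (.inl (entry tm e)))
        | some b => emb (some (.inr ⟨b, entry tm (p b)⟩)))
    | some (.inl l) => code e (fun l => emb (some (.inl l))) exit l
    | some (.inr ⟨b, l⟩) => code (p b) (fun l => emb (some (.inr ⟨b, l⟩))) exit l
  | .loop v p, emb, exit, l => match l with
    | none => .pop (Sum.inl v) (fun x o => (o, x.2)) (.goto fun x => match x.1 with
        | none => exit
        | some b => emb (some ⟨b, entry tm (p b)⟩))
    | some ⟨b, l⟩ => code (p b) (fun l => emb (some ⟨b, l⟩)) (emb none) l
  | .call v w, emb, exit, l => match l with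
    | .inl true => .pop (Sum.inl v) (fun x o => (o, x.2)) (.branch (fun x => x.1.isSome)
        (.push (Sum.inr tm.k₀) (fun x => inp.symm (x.1.getD false))
          (.goto fun _ => emb (.inl true)))
        (.goto fun _ => emb (.inr tm.main)))
    | .inl false => .pop (Sum.inr tm.k₁) (fun x o => (o.map outp, x.2))
        (.branch (fun x => x.1.isSome)
          (.push (Sum.inl w) (fun x => x.1.getD false) (.goto fun _ => emb (.inl false)))
          (.goto fun _ => exit))
    | .inr l => liftStmt tm (fun l => emb (.inr l)) (emb (.inl false)) (tm.m l)

/-- The stacks of the compiled machine: those of the program and those of `tm`. -/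
def joinStk (s : V → List Bool) (S : ∀ k, List (tm.Γ k)) : ∀ k, List (Alph tm V k)
  | .inl v => s v
  | .inr k => S k

omit [DecidableEq V] in
@[simp] theorem joinStk_inl (s : V → List Bool) (S : ∀ k, List (tm.Γ k)) (v : V) :
    joinStk tm s S (.inl v) = s v := rfl

omit [DecidableEq V] in
@[simp] theorem joinStk_inr (s : V → List Bool) (S : ∀ k, List (tm.Γ k)) (k : tm.K) :
    joinStk tm s S (.inr k) = S k := rfl

@[simp] theorem update_joinStk_inl (s : V → List Bool) (S : ∀ k, List (tm.Γ k)) (v : V)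
    (l : List Bool) : update (joinStk tm s S) (.inl v) l = joinStk tm (update s v l) S := by
  funext k
  rcases k with w | k
  · by_cases h : w = v
    · subst h; simp
    · simp [h]
  · simp

@[simp] theorem update_joinStk_inr (s : V → List Bool) (S : ∀ k, List (tm.Γ k)) (k : tm.K)
    (l : List (tm.Γ k)) : update (joinStk tm s S) (.inr k) l = joinStk tm s (update S k l) := by
  funext k'
  rcases k' with w | k'
  · simp
  · by_cases h : k' = k
    · subst h; simp
    · simp [h]

theorem joinStk_update_nil (v : V) (l : List Bool) :
    joinStk tm (update (fun _ => []) v l) (fun _ => []) =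
      update (fun _ => [] : ∀ k, List (Alph tm V k)) (Sum.inl v) l := by
  rw [← update_joinStk_inl]
  congr 1
  funext k
  cases k <;> rfl

/-- `Steps f c t c'` means that exactly `t` steps of `f` lead from `c` to `c'`. -/
def Steps {C : Type} (f : C → Option C) (c : C) (t : ℕ) (c' : C) : Prop :=
  (flip bind f)^[t] (some c) = some c'

theorem Steps.trans {C : Type} {f : C → Option C} {a b c : C} {t u : ℕ} (h : Steps f a t b)
    (h' : Steps f b u c) : Steps f a (t + u) c := by
  unfold Steps at *
  rw [Nat.add_comm, iterate_add_apply, h, h']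

theorem Steps.one {C : Type} {f : C → Option C} {a b : C} (h : f a = some b) : Steps f a 1 b := h

theorem flip_bind_iterate_none {C : Type} (f : C → Option C) (t : ℕ) :
    (flip bind f)^[t] none = none := by
  induction t with
  | zero => rfl
  | succ t ih => rw [iterate_succ_apply]; exact ih

theorem Steps.succ_iff {C : Type} {f : C → Option C} {a c : C} {t : ℕ} :
    Steps f a (t + 1) c ↔ ∃ b, f a = some b ∧ Steps f b t c := by
  unfold Steps
  rw [iterate_succ_apply]
  have : flip bind f (some a) = f a := rfl
  rw [this]
  cases h : f a with
  | none =>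
    have := flip_bind_iterate_none f t
    simp_all
  | some b => simp

section Run

variable {tm} {Λ : Type}

/-- The configuration of the compiled machine, with stacks `s` of the program, that stands for the
configuration `c` of `tm`. -/
abbrev stepRes (emb : tm.Λ → Λ) (exit : Λ) (x : Option Bool) (s : V → List Bool)
    (c : TM2.Cfg tm.Γ tm.Λ tm.σ) : TM2.Cfg (Alph tm V) Λ (Reg tm) :=
  ⟨some (c.l.elim exit emb), (x, c.var), joinStk tm s c.stk⟩

theorem stepAux_liftStmt (emb : tm.Λ → Λ) (exit : Λ) (x : Option Bool) (s : V → List Bool)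
    (q : TM2.Stmt tm.Γ tm.Λ tm.σ) (y : tm.σ) (S : ∀ k, List (tm.Γ k)) :
    TM2.stepAux (liftStmt tm emb exit q) (x, y) (joinStk tm s S) =
      stepRes emb exit x s (TM2.stepAux q y S) := by
  induction q generalizing y S with
  | push k f q ih => simp [liftStmt, ih]
  | peek k f q ih => simp [liftStmt, ih]
  | pop k f q ih => simp [liftStmt, ih]
  | load f q ih => simp [liftStmt, ih]
  | branch f q q' ih ih' => cases h : f y <;> simp [liftStmt, ih, ih', h]
  | goto l => rfl
  | halt => rfl

/-- Inside a call, the compiled machine simulates `tm` step by step. -/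
theorem steps_lift {M : Λ → Code tm V Λ} {emb : tm.Λ → Λ} {exit : Λ}
    (hM : ∀ l, M (emb l) = liftStmt tm emb exit (tm.m l)) (x : Option Bool) (s : V → List Bool)
    {t : ℕ} {c c' : TM2.Cfg tm.Γ tm.Λ tm.σ} (h : Steps (TM2.step tm.m) c t c') :
    Steps (TM2.step M) (stepRes emb exit x s c) t (stepRes emb exit x s c') := by
  induction t generalizing c with
  | zero =>
    cases h
    rfl
  | succ t ih =>
    obtain ⟨d, hd, h⟩ := Steps.succ_iff.1 h
    refine Steps.succ_iff.2 ⟨_, ?_, ih h⟩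
    obtain ⟨l, y, S⟩ := c
    cases l with
    | none => simp at hd
    | some l =>
      simp only [TM2.step, Option.some.injEq] at hd
      have : (stepRes emb exit x s ⟨some l, y, S⟩ : TM2.Cfg (Alph tm V) Λ (Reg tm)) =
          ⟨some (emb l), (x, y), joinStk tm s S⟩ := rfl
      rw [this, TM2.step, hM, stepAux_liftStmt, hd]

/-- The oracle that runs the machine `tm`, whose input and output alphabets are identified with
`Bool` by `inp` and `outp`. -/
def machineOracle : Oracle where
  run w t out :=
    Steps (TM2.step tm.m) (initList tm (w.map inp.symm)) t (haltList tm (out.map outp.symm))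

theorem initList_stk_self (l : List (tm.Γ tm.k₀)) :
    (initList tm l).stk = update (fun _ => []) tm.k₀ l := by
  funext k
  by_cases h : k = tm.k₀
  · subst h; simp [initList]
  · simp [initList, h]

theorem haltList_stk_self (l : List (tm.Γ tm.k₁)) :
    (haltList tm l).stk = update (fun _ => []) tm.k₁ l := by
  funext k
  by_cases h : k = tm.k₁
  · subst h; simp [haltList]
  · simp [haltList, h]

variable {inp outp}

/-- The first phase of a call moves the stack `v` to the input stack of `tm`. -/
theorem steps_load {M : Λ → Code tm V Λ} {v : V} {l l' : Λ}
    (hM : M l = .pop (Sum.inl v) (fun x o => (o, x.2)) (.branch (fun x => x.1.isSome)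
        (.push (Sum.inr tm.k₀) (fun x => inp.symm (x.1.getD false)) (.goto fun _ => l))
        (.goto fun _ => l'))) (u : List Bool) (x : Option Bool) (y : tm.σ)
    (s : V → List Bool) (S : List (tm.Γ tm.k₀)) :
    ∃ x', Steps (TM2.step M)
      ⟨some l, (x, y), joinStk tm (update s v u) (update (fun _ => []) tm.k₀ S)⟩
      (u.length + 1)
      ⟨some l', (x', y), joinStk tm (update s v [])
        (update (fun _ => []) tm.k₀ (u.reverse.map inp.symm ++ S))⟩ := by
  induction u generalizing x S with
  | nil => exact ⟨none, Steps.one (by simp [hM])⟩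
  | cons b u ih =>
    obtain ⟨x', h⟩ := ih (some b) (inp.symm b :: S)
    refine ⟨x', Steps.succ_iff.2 ⟨_, ?_, by simpa using h⟩⟩
    simp [hM]

/-- The last phase of a call moves the output stack of `tm` to the stack `w`. -/
theorem steps_unload {M : Λ → Code tm V Λ} {w : V} {l l' : Λ}
    (hM : M l = .pop (Sum.inr tm.k₁) (fun x o => (o.map outp, x.2))
        (.branch (fun x => x.1.isSome)
          (.push (Sum.inl w) (fun x => x.1.getD false) (.goto fun _ => l))
          (.goto fun _ => l'))) (u : List Bool) (x : Option Bool) (y : tm.σ)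
    (s : V → List Bool) (r : List Bool) :
    ∃ x', Steps (TM2.step M) ⟨some l, (x, y), joinStk tm (update s w r)
        (update (fun _ => []) tm.k₁ (u.map outp.symm))⟩ (u.length + 1)
      ⟨some l', (x', y), joinStk tm (update s w (u.reverse ++ r)) (fun _ => [])⟩ := by
  induction u generalizing x r with
  | nil => exact ⟨none, Steps.one (by simp [hM])⟩
  | cons b u ih =>
    obtain ⟨x', h⟩ := ih (some b) (b :: r)
    refine ⟨x', Steps.succ_iff.2 ⟨_, ?_, by simpa using h⟩⟩
    simp [hM]

/-- Correctness of the compilation: the code of a program carries out its runs, in the same time.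
The stacks of `tm` are empty and its memory is in the initial state between calls. -/
theorem Exec.steps {p : Prog V} {s s' : V → List Bool} {t : ℕ}
    (h : Exec (machineOracle inp outp) p s t s') {M : Λ → Code tm V Λ} {emb : Lab tm p → Λ}
    {exit : Λ} (hM : ∀ l, M (emb l) = code tm inp outp p emb exit l) (x : Option Bool) :
    ∃ x', Steps (TM2.step M)
      ⟨some (emb (entry tm p)), (x, tm.initialState), joinStk tm s (fun _ => [])⟩ t
      ⟨some exit, (x', tm.initialState), joinStk tm s' (fun _ => [])⟩ := by
  induction h generalizing x exit with
  | skip s => exact ⟨x, Steps.one (by simp [hM, code])⟩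
  | push v b s => exact ⟨x, Steps.one (by simp [hM, code])⟩
  | @seq p q s t s' t' s'' h h' ih ih' =>
    obtain ⟨x₁, h₁⟩ := ih (emb := fun l => emb (.inl l)) (fun l => hM (.inl l)) x
    obtain ⟨x₂, h₂⟩ := ih' (emb := fun l => emb (.inr l)) (fun l => hM (.inr l)) x₁
    exact ⟨x₂, h₁.trans h₂⟩
  | @case_nil v e p s t s' hv h ih =>
    obtain ⟨x₁, h₁⟩ := ih (emb := fun l => emb (some (.inl l))) (fun l => hM (some (.inl l))) none
    refine ⟨x₁, (Steps.one ?_).trans h₁⟩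
    have : update s v [] = s := by rw [← hv, update_eq_self]
    have h₀ := hM none
    simp only [code] at h₀
    simp [h₀, entry, hv, this]
  | @case_cons v e p s t s' b l hv h ih =>
    obtain ⟨x₁, h₁⟩ := ih (emb := fun l => emb (some (.inr ⟨b, l⟩)))
      (fun l => hM (some (.inr ⟨b, l⟩))) (some b)
    refine ⟨x₁, (Steps.one ?_).trans h₁⟩
    have h₀ := hM none
    simp only [code] at h₀
    simp [h₀, entry, hv]
  | @loop_nil v p s hv =>
    refine ⟨none, Steps.one ?_⟩
    have : update s v [] = s := by rw [← hv, update_eq_self]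
    have h₀ := hM none
    simp only [code] at h₀
    simp [h₀, entry, hv, this]
  | @loop_cons v p s t s' t' s'' b l hv h h' ih ih' =>
    obtain ⟨x₁, h₁⟩ := ih (emb := fun l => emb (some ⟨b, l⟩))
      (fun l => hM (some ⟨b, l⟩)) (some b)
    obtain ⟨x₂, h₂⟩ := ih' hM x₁
    refine ⟨x₂, ((Steps.one ?_).trans h₁).trans h₂⟩
    have h₀ := hM none
    simp only [code] at h₀
    simp [h₀, entry, hv]
  | @call v w s t out h =>
    obtain ⟨x₁, h₁⟩ := steps_load (hM (.inl true)) (s v) x tm.initialState s []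
    have h₂ := steps_lift (fun l => hM (.inr l)) x₁ (update s v []) h
    obtain ⟨x₃, h₃⟩ := steps_unload (hM (.inl false)) out x₁ tm.initialState (update s v [])
      (update s v [] w)
    simp only [stepRes, initList_stk_self, haltList_stk_self] at h₂
    refine ⟨x₃, (Steps.trans ?_ h₂).trans ?_⟩
    · simpa [initList, entry] using h₁
    · simpa [haltList] using h₃

end Run

instance (p : Prog V) : Fintype (Lab tm p) := Lab.fintype tm p

instance : Fintype (Reg tm) :=
  haveI := tm.σFin
  inferInstanceAs (Fintype (Option Bool × tm.σ))

/-- The Turing machine for a program with input stack `vin` and output stack `vout`. The label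
`none` is reached when the program has stopped; there the memory is reset, as the final
configuration of `Turing.TM2Outputs` requires the initial state. -/
def compiled [Fintype V] (p : Prog V) (vin vout : V) : FinTM2 where
  K := V ⊕ tm.K
  kFin := haveI := tm.kFin; inferInstance
  k₀ := Sum.inl vin
  k₁ := Sum.inl vout
  Γ := Alph tm V
  Λ := Option (Lab tm p)
  main := some (entry tm p)
  σ := Reg tm
  initialState := (none, tm.initialState)
  Γk₀Fin := inferInstanceAs (Fintype Bool)
  m l := match l with
    | some l => code tm inp outp p some none l
    | none => .load (fun x => (none, x.2)) .halt

variable {tm inp outp}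

/-- A function that a stack program computes in polynomial time, leaving all stacks but the output
stack empty, is computed in polynomial time by a Turing machine. -/
theorem nonempty_polyTime_of_exec [Fintype V] {α β : Type} {ea : α → List Bool}
    {eb : β → List Bool} {f : α → β} (p : Prog V) (vin vout : V) (P : Polynomial ℕ)
    (h : ∀ a, ∃ t ≤ P.eval (ea a).length, Exec (machineOracle inp outp) p
      (update (fun _ => []) vin (ea a)) t (update (fun _ => []) vout (eb (f a)))) :
    Nonempty (TM2ComputableInPolyTime ea eb f) := by
  refine ⟨⟨⟨compiled tm inp outp p vin vout, Equiv.refl Bool, Equiv.refl Bool⟩, P + 1, fun a => ?_⟩⟩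
  have key : ∃ t ≤ P.eval (ea a).length + 1, Steps (compiled tm inp outp p vin vout).step
      (initList (compiled tm inp outp p vin vout) (ea a)) t
      (haltList (compiled tm inp outp p vin vout) (eb (f a))) := by
    obtain ⟨t, ht, h⟩ := h a
    obtain ⟨x, hx⟩ := h.steps (M := (compiled tm inp outp p vin vout).m) (emb := some)
      (exit := none) (fun l => rfl) none
    refine ⟨t + 1, by omega, Steps.trans (b := ⟨some none, (x, tm.initialState),
      joinStk tm (update (fun _ => []) vout (eb (f a))) (fun _ => [])⟩) ?_ ?_⟩
    · have : initList (compiled tm inp outp p vin vout) (ea a) =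
          ⟨some (some (entry tm p)), (none, tm.initialState),
            joinStk tm (update (fun _ => []) vin (ea a)) (fun _ => [])⟩ := by
        have h₁ := initList_stk_self (tm := compiled tm inp outp p vin vout) (ea a)
        rw [joinStk_update_nil]
        unfold initList at h₁ ⊢
        exact congrArg (TM2.Cfg.mk _ _) h₁
      rw [this]
      exact hx
    · refine Steps.one ?_
      have h₁ := haltList_stk_self (tm := compiled tm inp outp p vin vout) (eb (f a))
      rw [joinStk_update_nil]
      unfold haltList at h₁ ⊢
      exact congrArg some (congrArg (TM2.Cfg.mk _ _) h₁.symm)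
  have hl : ∀ l : List Bool, l.map (Equiv.refl Bool).invFun = l := fun l => List.map_id l
  have e : (P + 1).eval (ea a).length = P.eval (ea a).length + 1 := by simp
  choose t ht hs using key
  rw [e]
  refine ⟨⟨t, ?_⟩, ht⟩
  have e₁ := hl (ea a)
  have e₂ := hl (eb (f a))
  unfold Steps at hs
  convert hs using 2
  · exact congrArg some (congrArg (initList (compiled tm inp outp p vin vout)) e₁)
  · exact congrArg (fun l => some (haltList (compiled tm inp outp p vin vout) l)) e₂

end Compile

/-! ### Renaming of stacks -/

variable {O : Oracle}

/-- Renames the stacks of a program. -/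
def Prog.map (φ : V → W) : Prog V → Prog W
  | .skip => .skip
  | .push v b => .push (φ v) b
  | .seq p q => .seq (p.map φ) (q.map φ)
  | .case v e p => .case (φ v) (e.map φ) fun b => (p b).map φ
  | .loop v p => .loop (φ v) fun b => (p b).map φ
  | .call v w => .call (φ v) (φ w)

theorem extend_update {φ : V → W} (hφ : Injective φ) (s : V → List Bool) (S : W → List Bool)
    (v : V) (l : List Bool) :
    extend φ (update s v l) S = update (extend φ s S) (φ v) l := by
  funext w
  by_cases h : ∃ u, φ u = w
  · obtain ⟨u, rfl⟩ := h
    rw [hφ.extend_apply]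
    by_cases hu : u = v
    · subst hu; simp
    · rw [update_of_ne hu, update_of_ne (hφ.ne hu), hφ.extend_apply]
  · rw [extend_apply' _ _ _ h, update_of_ne, extend_apply' _ _ _ h]
    rintro rfl
    exact h ⟨v, rfl⟩

/-- A program can be run on some of the stacks of a larger family; the others are unchanged. -/
theorem Exec.map_extend {φ : V → W} (hφ : Injective φ) (S : W → List Bool) {p : Prog V}
    {s s' : V → List Bool} {t : ℕ} (h : Exec O p s t s') :
    Exec O (p.map φ) (extend φ s S) t (extend φ s' S) := by
  induction h with
  | skip s => exact .skip _
  | push v b s =>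
    have := Exec.push (O := O) (φ v) b (extend φ s S)
    rwa [hφ.extend_apply, ← extend_update hφ] at this
  | seq _ _ ih ih' => exact .seq ih ih'
  | case_nil hv _ ih => exact .case_nil (by rwa [hφ.extend_apply]) ih
  | case_cons hv _ ih =>
    refine .case_cons (by rwa [hφ.extend_apply]) ?_
    rwa [← extend_update hφ]
  | loop_nil hv => exact .loop_nil (by rwa [hφ.extend_apply])
  | loop_cons hv _ _ ih ih' =>
    refine .loop_cons (by rwa [hφ.extend_apply]) ?_ ih'
    rwa [← extend_update hφ]
  | @call v w s t out h =>
    have := Exec.call (O := O) (v := φ v) (w := φ w) (s := extend φ s S) (t := t) (out := out)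
      (by rwa [hφ.extend_apply])
    rwa [← extend_update hφ, hφ.extend_apply, hφ.extend_apply, ← extend_update hφ] at this

theorem sum_length_update [Fintype V] (s : V → List Bool) (v : V) (l : List Bool) :
    ∑ u, (update s v l u).length + (s v).length = ∑ u, (s u).length + l.length := by
  rw [← Finset.add_sum_erase _ _ (Finset.mem_univ v),
    ← Finset.add_sum_erase (a := v) _ (fun u => (s u).length) (Finset.mem_univ v)]
  have : ∑ u ∈ Finset.univ.erase v, (update s v l u).length =
      ∑ u ∈ Finset.univ.erase v, (s u).length :=
    Finset.sum_congr rfl fun u hu => by rw [update_of_ne (Finset.ne_of_mem_erase hu)]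
  rw [this, update_self]
  ring

/-- The stacks grow by at most one bit per step, so a program with short running time has short
output. -/
theorem Exec.sum_length_le [Fintype V] {p : Prog V} {s s' : V → List Bool} {t : ℕ}
    (h : Exec O p s t s') : ∑ v, (s' v).length ≤ ∑ v, (s v).length + t := by
  induction h with
  | skip s => omega
  | push v b s =>
    have := sum_length_update s v (b :: s v)
    simp only [List.length_cons] at this
    omega
  | seq _ _ ih ih' => omega
  | case_nil hv _ ih => omega
  | @case_cons v e p s t s' b l hv _ ih =>
    have := sum_length_update s v l
    simp only [hv, List.length_cons] at this
    omega
  | loop_nil hv => omega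
  | @loop_cons v p s t s' t' s'' b l hv _ _ ih ih' =>
    have := sum_length_update s v l
    simp only [hv, List.length_cons] at this
    omega
  | @call v w s t out h =>
    have h₁ := sum_length_update s v []
    have h₂ := sum_length_update (update s v []) w (out.reverse ++ update s v [] w)
    simp only [List.length_append, List.length_reverse, List.length_nil] at h₁ h₂
    omega

/-! ### Runs within a time bound -/

/-- `p` leads from the stacks `s` to the stacks `s'` in at most `T` steps. -/
def Runs (O : Oracle) (p : Prog V) (s : V → List Bool) (T : ℕ)
    (s' : V → List Bool) : Prop :=
  ∃ t ≤ T, Exec O p s t s'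

namespace Runs

variable {p q : Prog V} {s s' s'' : V → List Bool} {T T' : ℕ} {v w : V}

theorem mono (h : Runs O p s T s') (hT : T ≤ T') : Runs O p s T' s' := by
  obtain ⟨t, ht, h⟩ := h
  exact ⟨t, ht.trans hT, h⟩

theorem mono' (h : Runs O p s T s') (hT : T ≤ T') (hs : s' = s'') : Runs O p s T' s'' :=
  hs ▸ h.mono hT

theorem skip : Runs O .skip s 1 s := ⟨1, le_rfl, .skip s⟩

theorem push {b : Bool} : Runs O (.push v b) s 1 (update s v (b :: s v)) := ⟨1, le_rfl, .push v b s⟩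

theorem push_of_eq {b : Bool} (h : s' = update s v (b :: s v)) : Runs O (.push v b) s 1 s' :=
  h ▸ push

theorem seq (h : Runs O p s T s') (h' : Runs O q s' T' s'') :
    Runs O (.seq p q) s (T + T') s'' := by
  obtain ⟨t, ht, h⟩ := h
  obtain ⟨t', ht', h'⟩ := h'
  exact ⟨t + t', by omega, h.seq h'⟩

theorem case_nil {r : Bool → Prog V} (hv : s v = []) (h : Runs O p s T s') :
    Runs O (.case v p r) s (1 + T) s' := by
  obtain ⟨t, ht, h⟩ := h
  exact ⟨1 + t, by omega, h.case_nil hv⟩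

theorem case_cons {r : Bool → Prog V} {b : Bool} {l : List Bool} (hv : s v = b :: l)
    (h : Runs O (r b) (update s v l) T s') : Runs O (.case v p r) s (1 + T) s' := by
  obtain ⟨t, ht, h⟩ := h
  exact ⟨1 + t, by omega, h.case_cons hv⟩

/-- The loop rule. `J d l` describes the stacks when the bits `d` have been popped from `v` (the
last one first) and the bits `l` remain. -/
theorem loop {r : Bool → Prog V} {J : List Bool → List Bool → V → List Bool} {n : ℕ}
    (hJ : ∀ d l, J d l v = l)
    (h : ∀ d b l, d.length + l.length + 1 = n →
      Runs O (r b) (update (J d (b :: l)) v l) T (J (b :: d) l))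
    (d l : List Bool) (hn : d.length + l.length = n) :
    Runs O (.loop v r) (J d l) (l.length * (T + 1) + 1) (J (l.reverse ++ d) []) := by
  induction l generalizing d with
  | nil => exact ⟨1, by simp, .loop_nil (hJ d [])⟩
  | cons b l ih =>
    simp only [List.length_cons] at hn
    obtain ⟨t, ht, h₁⟩ := h d b l (by omega)
    obtain ⟨t', ht', h₂⟩ := ih (b :: d) (by simp; omega)
    refine ⟨1 + t + t', ?_, .loop_cons (hJ _ _) h₁ (by simpa using h₂)⟩
    rw [List.length_cons, add_one_mul]
    omega

theorem map {φ : V → W} (hφ : Injective φ) {S S' : W → List Bool}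
    (h : Runs O p (fun v => S (φ v)) T (fun v => S' (φ v)))
    (hS : ∀ w, (∀ v, φ v ≠ w) → S' w = S w) : Runs O (p.map φ) S T S' := by
  obtain ⟨t, ht, h⟩ := h
  refine ⟨t, ht, ?_⟩
  have := h.map_extend hφ S
  convert this using 1
  · funext w
    by_cases h : ∃ u, φ u = w
    · obtain ⟨u, rfl⟩ := h
      rw [hφ.extend_apply]
    · rw [extend_apply' _ _ _ h]
  · funext w
    by_cases h : ∃ u, φ u = w
    · obtain ⟨u, rfl⟩ := h
      rw [hφ.extend_apply]
    · rw [extend_apply' _ _ _ h, hS w (by simpa using h)]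

end Runs

/-- Runs the programs `P i` one after the other. -/
noncomputable def Prog.forAll {ι : Type} [Fintype ι] (P : ι → Prog V) : Prog V :=
  ((Finset.univ : Finset ι).toList.map P).foldr .seq .skip

/-- `J A` describes the stacks when the programs `P i` with `i ∈ A` have been run. -/
theorem Runs.forAll {ι : Type} [Fintype ι] [DecidableEq ι] {P : ι → Prog V}
    {J : Finset ι → V → List Bool} {T : ℕ}
    (h : ∀ A i, i ∉ A → Runs O (P i) (J A) T (J (insert i A))) :
    Runs O (Prog.forAll P) (J ∅) (Fintype.card ι * T + 1) (J Finset.univ) := by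
  have key : ∀ (l : List ι) (A : Finset ι), l.Nodup → (∀ i ∈ l, i ∉ A) →
      Runs O ((l.map P).foldr .seq .skip) (J A) (l.length * T + 1) (J (A ∪ l.toFinset)) := by
    intro l
    induction l with
    | nil => intro A _ _; simpa using Runs.skip
    | cons i l ih =>
      intro A hl hA
      have h₁ := h A i (hA i (by simp))
      have h₂ := ih (insert i A) hl.of_cons (fun j hj => by
        have := hA j (by simp [hj])
        have : j ≠ i := by
          rintro rfl
          exact (List.nodup_cons.1 hl).1 hj
        simp_all)
      have e : insert i A ∪ l.toFinset = A ∪ (i :: l).toFinset := by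
        ext; simp
      rw [e] at h₂
      refine (h₁.seq h₂).mono ?_
      rw [List.length_cons, add_one_mul]
      omega
  simpa [Prog.forAll] using key Finset.univ.toList ∅ (Finset.nodup_toList _) (by simp)

/-! ### Clearing, moving and copying stacks -/

/-- Empties the stack `v`. -/
def Prog.clear (v : V) : Prog V := .loop v fun _ => .skip

theorem Runs.clear (s : V → List Bool) (v : V) :
    Runs O (.clear v) s (2 * (s v).length + 1) (update s v []) := by
  have := Runs.loop (O := O) (T := 1) (v := v) (r := fun _ => Prog.skip)
    (J := fun _ l => update s v l)
    (n := (s v).length)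
    (by simp) (fun d b l _ => by simpa using Runs.skip) [] (s v) (by simp)
  simp only [update_eq_self] at this
  exact this.mono (by omega)

/-- Moves the stack `v` onto the stack `w`, which reverses it. -/
def Prog.move (v w : V) : Prog V := .loop v fun b => .push w b

theorem Runs.move (s : V → List Bool) {v w : V} (h : v ≠ w) :
    Runs O (.move v w) s (2 * (s v).length + 1)
      (update (update s v []) w ((s v).reverse ++ s w)) := by
  have step : ∀ d b l, Runs O (.push w b) (update (update (update s v (b :: l)) w (d ++ s w)) v l) 1
      (update (update s v l) w (b :: d ++ s w)) := by
    intro d b l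
    refine Runs.push_of_eq ?_
    funext u
    by_cases hu : u = w
    · subst hu; simp [h.symm]
    · by_cases hu' : u = v
      · subst hu'; simp [h]
      · simp [hu, hu']
  have := Runs.loop (J := fun d l => update (update s v l) w (d ++ s w)) (n := (s v).length)
    (by simp [h]) (fun d b l _ => step d b l) [] (s v) (by simp)
  simp only [update_eq_self, List.nil_append, List.append_nil] at this
  exact this.mono (by omega)

/-- Moves the stack `v` onto the stack `w` by way of the stack `u`, which restores its order. -/
def Prog.transfer (v w u : V) : Prog V := .seq (.move v u) (.move u w)

theorem Runs.transfer (s : V → List Bool) {v w u : V} (hvw : v ≠ w) (hvu : v ≠ u) (hwu : w ≠ u)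
    (hu : s u = []) :
    Runs O (.transfer v w u) s (4 * (s v).length + 2) (update (update s v []) w (s v ++ s w)) := by
  have h₁ := Runs.move (O := O) s hvu
  have h₂ := Runs.move (O := O) (update (update s v []) u ((s v).reverse ++ s u)) hwu.symm
  have h := h₁.seq h₂
  have e : update (update (update (update s v []) u ((s v).reverse ++ s u)) u []) w
      ((update (update s v []) u ((s v).reverse ++ s u) u).reverse ++
        update (update s v []) u ((s v).reverse ++ s u) w) =
      update (update s v []) w (s v ++ s w) := by
    funext x
    by_cases hw : x = w
    · subst hw; simp [hwu, hvw.symm, hu]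
    · by_cases hxu : x = u
      · subst hxu; simp [hwu.symm, hu, hvu.symm]
      · simp [hw, hxu]
  rw [e] at h
  refine h.mono ?_
  simp [hu]
  omega

/-- Puts a copy of the stack `v` onto the stack `w`, by way of the stack `u`. -/
def Prog.copy (v w u : V) : Prog V :=
  .seq (.move v u) (.loop u fun b => .seq (.push v b) (.push w b))

theorem Runs.copy (s : V → List Bool) {v w u : V} (hvw : v ≠ w) (hvu : v ≠ u) (hwu : w ≠ u)
    (hu : s u = []) :
    Runs O (.copy v w u) s (5 * (s v).length + 2) (update s w (s v ++ s w)) := by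
  have h₁ := Runs.move (O := O) s hvu
  have step : ∀ d b l, Runs O (.seq (.push v b) (.push w b))
      (update (update (update (update s v d) w (d ++ s w)) u (b :: l)) u l) 2
      (update (update (update s v (b :: d)) w (b :: d ++ s w)) u l) := by
    intro d b l
    refine Runs.seq (T := 1) Runs.push (Runs.push_of_eq ?_)
    funext x
    by_cases hw : x = w
    · subst hw; simp [hwu, hvw.symm]
    · by_cases hxu : x = u
      · subst hxu; simp [hwu.symm, hvu.symm]
      · by_cases hxv : x = v
        · subst hxv; simp [hvu, hvw]
        · simp [hw, hxu, hxv]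
  have h₂ := Runs.loop (J := fun d l => update (update (update s v d) w (d ++ s w)) u l)
    (n := (s v).length) (by simp) (fun d b l _ => step d b l) [] (s v).reverse (by simp)
  have e : update (update (update s v []) w ([] ++ s w)) u (s v).reverse =
      update (update s v []) u ((s v).reverse ++ s u) := by
    funext x
    by_cases hw : x = w
    · subst hw; simp [hwu, hvw.symm]
    · by_cases hxu : x = u
      · subst hxu; simp [hu]
      · by_cases hxv : x = v
        · subst hxv; simp [hvu, hvw]
        · simp [hw, hxu, hxv]
  rw [e] at h₂
  have h : Runs O (.copy v w u) s (5 * (s v).length + 2) _ :=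
    (h₁.seq h₂).mono (by simp; omega)
  convert h using 1
  funext x
  by_cases hw : x = w
  · subst hw; simp [hwu]
  · by_cases hxu : x = u
    · subst hxu; simp [hwu.symm, hu]
    · simp [hw, hxu]

/-! ### Clearing, copying and moving families of stacks -/

section All

variable {ι : Type} [Fintype ι] [DecidableEq ι]

theorem Runs.clearAll {φ : ι → V} (hφ : Injective φ) {S S' : V → List Bool} {N : ℕ}
    (hφS : ∀ i, S' (φ i) = []) (hS : ∀ v, (∀ i, φ i ≠ v) → S' v = S v)
    (hN : ∀ i, (S (φ i)).length ≤ N) :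
    Runs O (Prog.forAll fun i => .clear (φ i)) S (Fintype.card ι * (2 * N + 1) + 1) S' := by
  have h := Runs.forAll (O := O) (P := fun i => .clear (φ i)) (T := 2 * N + 1)
    (J := fun A => extend φ (fun i => if i ∈ A then [] else S (φ i)) S) (by
      intro A i hi
      have h := Runs.clear (O := O) (extend φ (fun i => if i ∈ A then [] else S (φ i)) S) (φ i)
      rw [← extend_update hφ, hφ.extend_apply, if_neg hi] at h
      convert h.mono (T' := 2 * N + 1) (by have := hN i; omega) using 2
      funext j
      by_cases hj : j = i
      · subst hj; simp
      · simp [hj])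
  convert h using 1
  · funext v
    by_cases hv : ∃ i, φ i = v
    · obtain ⟨i, rfl⟩ := hv
      simp [hφ.extend_apply]
    · rw [extend_apply' _ _ _ hv]
  · funext v
    by_cases hv : ∃ i, φ i = v
    · obtain ⟨i, rfl⟩ := hv
      simp [hφ.extend_apply, hφS]
    · rw [extend_apply' _ _ _ hv, hS v (by simpa using hv)]

theorem Runs.copyAll {φ ψ : ι → V} {u : V} (hψ : Injective ψ) {S S' : V → List Bool} {N : ℕ}
    (hφψ : ∀ i j, ψ j ≠ φ i) (hφu : ∀ i, φ i ≠ u) (hψu : ∀ i, ψ i ≠ u) (hu : S u = [])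
    (hψS : ∀ i, S (ψ i) = []) (hψS' : ∀ i, S' (ψ i) = S (φ i))
    (hS : ∀ v, (∀ i, ψ i ≠ v) → S' v = S v)
    (hN : ∀ i, (S (φ i)).length ≤ N) :
    Runs O (Prog.forAll fun i => .copy (φ i) (ψ i) u) S (Fintype.card ι * (5 * N + 2) + 1) S' := by
  have hφ : ∀ (A : Finset ι) i,
      extend ψ (fun i => if i ∈ A then S (φ i) else []) S (φ i) = S (φ i) :=
    fun A i => extend_apply' _ _ _ (by simpa using fun j => hφψ i j)
  have h := Runs.forAll (O := O) (P := fun i => .copy (φ i) (ψ i) u) (T := 5 * N + 2)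
    (J := fun A => extend ψ (fun i => if i ∈ A then S (φ i) else []) S) (by
      intro A i hi
      have h := Runs.copy (O := O) (extend ψ (fun i => if i ∈ A then S (φ i) else []) S)
        (v := φ i) (w := ψ i) (u := u) (hφψ i i).symm (hφu i) (hψu i)
        (by rw [extend_apply' _ _ _ (by simpa using hψu), hu])
      rw [← extend_update hψ, hψ.extend_apply, if_neg hi, hφ] at h
      convert h.mono (T' := 5 * N + 2) (by have := hN i; omega) using 2
      funext j
      by_cases hj : j = i
      · subst hj; simp
      · simp [hj])
  convert h using 1
  · funext v
    by_cases hv : ∃ i, ψ i = v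
    · obtain ⟨i, rfl⟩ := hv
      simp [hψ.extend_apply, hψS]
    · rw [extend_apply' _ _ _ hv]
  · funext v
    by_cases hv : ∃ i, ψ i = v
    · obtain ⟨i, rfl⟩ := hv
      simp [hψ.extend_apply, hψS']
    · rw [extend_apply' _ _ _ hv, hS v (by simpa using hv)]

theorem Runs.transferAll {φ ψ : ι → V} {u : V} (hφ : Injective φ) (hψ : Injective ψ)
    {S S' : V → List Bool} {N : ℕ}
    (hφψ : ∀ i j, ψ j ≠ φ i) (hφu : ∀ i, φ i ≠ u) (hψu : ∀ i, ψ i ≠ u) (hu : S u = [])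
    (hψS : ∀ i, S (ψ i) = []) (hψS' : ∀ i, S' (ψ i) = S (φ i)) (hφS' : ∀ i, S' (φ i) = [])
    (hS : ∀ v, (∀ i, ψ i ≠ v) → (∀ i, φ i ≠ v) → S' v = S v)
    (hN : ∀ i, (S (φ i)).length ≤ N) :
    Runs O (Prog.forAll fun i => .transfer (φ i) (ψ i) u) S
      (Fintype.card ι * (4 * N + 2) + 1) S' := by
  have key : ∀ j, ¬ ∃ i, φ i = ψ j := fun j => by
    rintro ⟨i, h⟩
    exact hφψ i j h.symm
  let J : Finset ι → V → List Bool := fun A =>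
    extend φ (fun i => if i ∈ A then [] else S (φ i))
      (extend ψ (fun i => if i ∈ A then S (φ i) else []) S)
  have h := Runs.forAll (O := O) (P := fun i => .transfer (φ i) (ψ i) u) (T := 4 * N + 2)
    (J := J) (by
      intro A i hi
      have h := Runs.transfer (O := O) (J A)
        (v := φ i) (w := ψ i) (u := u) (hφψ i i).symm (hφu i) (hψu i)
        (by
          simp only [J]
          rw [extend_apply' _ _ _ (by simpa using hφu),
            extend_apply' _ _ _ (by simpa using hψu), hu])
      have e₁ : J A (φ i) = S (φ i) := by simp [J, hφ.extend_apply, hi]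
      have e₂ : J A (ψ i) = [] := by
        simp only [J]
        rw [extend_apply' _ _ _ (key i), hψ.extend_apply, if_neg hi]
      rw [e₁, e₂, List.append_nil] at h
      convert h.mono (T' := 4 * N + 2) (by have := hN i; omega) using 1
      funext v
      by_cases hv : ∃ j, φ j = v
      · obtain ⟨j, rfl⟩ := hv
        rw [update_of_ne (hφψ j i).symm]
        by_cases hj : j = i
        · subst hj; simp [J, hφ.extend_apply]
        · rw [update_of_ne (hφ.ne hj)]
          simp [J, hφ.extend_apply, hj]
      · by_cases hv' : ∃ j, ψ j = v
        · obtain ⟨j, rfl⟩ := hv'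
          by_cases hj : j = i
          · subst hj
            simp only [J]
            rw [update_self, extend_apply' _ _ _ hv, hψ.extend_apply]
            simp
          · rw [update_of_ne (hψ.ne hj), update_of_ne (hφψ i j)]
            simp only [J]
            rw [extend_apply' _ _ _ hv, hψ.extend_apply, extend_apply' _ _ _ hv, hψ.extend_apply]
            simp [hj]
        · push Not at hv hv'
          rw [update_of_ne (hv' i).symm, update_of_ne (hv i).symm]
          simp only [J]
          rw [extend_apply' _ _ _ (by simpa using hv), extend_apply' _ _ _ (by simpa using hv'),
            extend_apply' _ _ _ (by simpa using hv), extend_apply' _ _ _ (by simpa using hv')])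
  convert h using 1
  · funext v
    by_cases hv : ∃ i, φ i = v
    · obtain ⟨i, rfl⟩ := hv
      simp [J, hφ.extend_apply]
    · simp only [J]
      rw [extend_apply' _ _ _ hv]
      by_cases hv' : ∃ j, ψ j = v
      · obtain ⟨j, rfl⟩ := hv'
        simp [hψ.extend_apply, hψS]
      · rw [extend_apply' _ _ _ hv']
  · funext v
    by_cases hv : ∃ i, φ i = v
    · obtain ⟨i, rfl⟩ := hv
      simp [J, hφ.extend_apply, hφS']
    · simp only [J]
      rw [extend_apply' _ _ _ hv]
      by_cases hv' : ∃ j, ψ j = v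
      · obtain ⟨j, rfl⟩ := hv'
        simp [hψ.extend_apply, hψS']
      · rw [extend_apply' _ _ _ hv', hS v (by simpa using hv') (by simpa using hv)]

end All

/-! ### Representation of data on stacks -/

/-- A representation of the elements of `α` by finitely many binary words. Natural numbers are
represented in unary. The representations below are faithful, but no lemma depends on it. -/
class Data (α : Type) where
  /-- the index type of the words -/
  Ix : Type
  [fintypeIx : Fintype Ix]
  [decEqIx : DecidableEq Ix]
  /-- the words that represent an element -/
  enc : α → Ix → List Bool

attribute [reducible, instance] Data.fintypeIx Data.decEqIx

open Data (Ix enc)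

instance : Data (List Bool) where
  Ix := Unit
  enc l _ := l

instance : Data ℕ where
  Ix := Unit
  enc n _ := List.replicate n true

instance : Data Bool where
  Ix := Unit
  enc b _ := [b]

instance {α β : Type} [Data α] [Data β] : Data (α × β) where
  Ix := Ix α ⊕ Ix β
  enc x := Sum.elim (enc x.1) (enc x.2)

instance {α : Type} [Data α] (k : ℕ) : Data (Fin k → α) where
  Ix := Fin k × Ix α
  enc x i := enc (x i.1) i.2

variable {α β γ : Type} [Data α] [Data β] [Data γ]

/-- The total length of the representation of `a`. -/
def size (a : α) : ℕ := ∑ i, (enc a i).length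

@[simp] theorem size_prod (x : α × β) : size x = size x.1 + size x.2 :=
  Fintype.sum_sum_type _

@[simp] theorem size_nat (n : ℕ) : size n = n := by
  change ∑ _ : Unit, (List.replicate n true).length = n
  simp

@[simp] theorem size_word (l : List Bool) : size l = l.length := by
  change ∑ _ : Unit, l.length = l.length
  simp

@[simp] theorem size_bool (b : Bool) : size b = 1 := by
  change ∑ _ : Unit, [b].length = 1
  simp

theorem length_enc_le (a : α) (i : Ix α) : (enc a i).length ≤ size a :=
  Finset.single_le_sum (f := fun i => (enc a i).length) (fun _ _ => Nat.zero_le _)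
    (Finset.mem_univ i)

/-! ### Polynomial bounds -/

theorem polynomial_eval_mono (P : Polynomial ℕ) {m n : ℕ} (h : m ≤ n) : P.eval m ≤ P.eval n := by
  rw [Polynomial.eval_eq_sum_range, Polynomial.eval_eq_sum_range]
  gcongr

/-- `T a` is bounded by a polynomial in the size of `a`. -/
def PolyBdd (T : α → ℕ) : Prop := ∃ P : Polynomial ℕ, ∀ a, T a ≤ P.eval (size a)

namespace PolyBdd

variable {T T' : α → ℕ}

theorem mono (h : PolyBdd T') (hT : ∀ a, T a ≤ T' a) : PolyBdd T := by
  obtain ⟨P, h⟩ := h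
  exact ⟨P, fun a => (hT a).trans (h a)⟩

theorem const (n : ℕ) : PolyBdd (fun _ : α => n) := ⟨Polynomial.C n, by simp⟩

theorem size : PolyBdd (fun a : α => size a) := ⟨Polynomial.X, by simp⟩

theorem add (h : PolyBdd T) (h' : PolyBdd T') : PolyBdd fun a => T a + T' a := by
  obtain ⟨P, h⟩ := h
  obtain ⟨P', h'⟩ := h'
  refine ⟨P + P', fun a => ?_⟩
  rw [Polynomial.eval_add]
  exact add_le_add (h a) (h' a)

theorem mul (h : PolyBdd T) (h' : PolyBdd T') : PolyBdd fun a => T a * T' a := by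
  obtain ⟨P, h⟩ := h
  obtain ⟨P', h'⟩ := h'
  refine ⟨P * P', fun a => ?_⟩
  rw [Polynomial.eval_mul]
  exact Nat.mul_le_mul (h a) (h' a)

theorem eval (h : PolyBdd T) (P : Polynomial ℕ) : PolyBdd fun a => P.eval (T a) := by
  obtain ⟨Q, h⟩ := h
  refine ⟨P.comp Q, fun a => ?_⟩
  rw [Polynomial.eval_comp]
  exact polynomial_eval_mono P (h a)

theorem comp {T : β → ℕ} (h : PolyBdd T) {f : α → β}
    (hf : PolyBdd fun a => StackProgram.size (f a)) :
    PolyBdd fun a => T (f a) := by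
  obtain ⟨P, h⟩ := h
  exact (hf.eval P).mono fun a => h _

end PolyBdd

/-! ### Functions computable in polynomial time -/

/-- The contents of input, output and work stacks. -/
abbrev st {A B C : Type} (a : A → List Bool) (b : B → List Bool) (c : C → List Bool) :
    A ⊕ B ⊕ C → List Bool := Sum.elim a (Sum.elim b c)

/-- Empty stacks. -/
abbrev nil {A : Type} : A → List Bool := fun _ => []

variable (O) in
/-- `f` is computed in polynomial time by a stack program, with calls of the oracle `O`. The program
keeps its input and leaves its work stacks empty, so that such programs can be composed. -/
@[fun_prop]
def Poly (f : α → β) : Prop :=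
  ∃ (ω : Type) (_ : Fintype ω) (_ : DecidableEq ω) (p : Prog (Ix α ⊕ Ix β ⊕ ω)) (T : α → ℕ),
    PolyBdd T ∧ ∀ a, Runs O p (st (enc a) nil nil) (T a) (st (enc a) (enc (f a)) nil)

namespace Poly

variable {f : α → β}

theorem size_le (hf : Poly O f) : PolyBdd fun a => size (f a) := by
  obtain ⟨ω, _, _, p, T, hT, h⟩ := hf
  refine hT.mono fun a => ?_
  obtain ⟨t, ht, h⟩ := h a
  have := h.sum_length_le
  simp only [st, Fintype.sum_sum_type, Sum.elim_inl, Sum.elim_inr, nil, List.length_nil,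
    Finset.sum_const_zero] at this
  unfold size
  omega

/-- A function that only rearranges the words of the representation is computed by copying. -/
theorem of_reindex (g : Ix β → Ix α) (h : ∀ a i, enc (f a) i = enc a (g i)) : Poly O f := by
  refine ⟨Unit, inferInstance, inferInstance,
    Prog.forAll fun i => .copy (Sum.inl (g i)) (Sum.inr (Sum.inl i)) (Sum.inr (Sum.inr ())),
    fun a => Fintype.card (Ix β) * (5 * size a + 2) + 1, ?_, fun a => ?_⟩
  · exact ((PolyBdd.const _).mul (((PolyBdd.const 5).mul .size).add (.const 2))).add (.const 1)
  · refine Runs.copyAll (fun i j h => by simpa using h) (by simp) (by simp) (by simp) rfl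
      (by simp) (fun i => by simp [h]) ?_ (fun i => length_enc_le a _)
    rintro (i | i | i) hi
    · simp
    · exact absurd rfl (hi i)
    · simp

/-- For `g` composed with a computable function, a program that uses up its input is enough. -/
theorem of_consume {g : β → γ} (hf : Poly O f) {ω : Type} [Fintype ω] [DecidableEq ω]
    (q : Prog (Ix β ⊕ Ix γ ⊕ ω)) {T : α → ℕ} (hT : PolyBdd T)
    (h : ∀ a, Runs O q (st (enc (f a)) nil nil) (T a) (st nil (enc (g (f a))) nil)) :
    Poly O fun a => g (f a) := by
  obtain ⟨ω', _, _, p, T', hT', h'⟩ := hf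
  let φ : Ix α ⊕ Ix β ⊕ ω' → Ix α ⊕ Ix γ ⊕ (Ix β ⊕ ω' ⊕ ω) :=
    Sum.elim Sum.inl (Sum.elim (fun i => .inr (.inr (.inl i))) fun i => .inr (.inr (.inr (.inl i))))
  let ψ : Ix β ⊕ Ix γ ⊕ ω → Ix α ⊕ Ix γ ⊕ (Ix β ⊕ ω' ⊕ ω) :=
    Sum.elim (fun i => .inr (.inr (.inl i)))
      (Sum.elim (fun i => .inr (.inl i)) fun i => .inr (.inr (.inr (.inr i))))
  refine ⟨Ix β ⊕ ω' ⊕ ω, inferInstance, inferInstance, .seq (p.map φ) (q.map ψ),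
    fun a => T' a + T a, hT'.add hT, fun a => ?_⟩
  refine Runs.seq (s' := st (enc a) nil (st (enc (f a)) nil nil)) (Runs.map ?_ ?_ ?_)
    (Runs.map ?_ ?_ ?_)
  · rintro (i | i | i) (j | j | j) h <;> simp_all [φ]
  · convert h' a using 1 <;> (funext i; rcases i with i | i | i <;> rfl)
  · rintro (i | i | i | i | i) hi
    · rfl
    · rfl
    · exact absurd rfl (hi (.inr (.inl i)))
    · rfl
    · rfl
  · rintro (i | i | i) (j | j | j) h <;> simp_all [ψ]
  · convert h a using 1 <;> (funext i; rcases i with i | i | i <;> rfl)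
  · rintro (i | i | i | i | i) hi
    · rfl
    · exact absurd rfl (hi (.inr (.inl i)))
    · exact absurd rfl (hi (.inl i))
    · rfl
    · rfl

@[fun_prop]
theorem comp {g : β → γ} (hg : Poly O g) (hf : Poly O f) : Poly O fun a => g (f a) := by
  have hs := hf.size_le
  obtain ⟨ω, _, _, q, T, hT, h⟩ := hg
  refine hf.of_consume (.seq q (Prog.forAll fun i => .clear (.inl i)))
    (T := fun a => T (f a) + (Fintype.card (Ix β) * (2 * size (f a) + 1) + 1)) ?_ fun a => ?_
  · exact (hT.comp hs).add (((PolyBdd.const _).mul (((PolyBdd.const 2).mul hs).add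
      (.const 1))).add (.const 1))
  · refine (h (f a)).seq (Runs.clearAll Sum.inl_injective (by simp) ?_
      (fun i => length_enc_le (f a) i))
    rintro (i | i) hi
    · exact absurd rfl (hi i)
    · rfl

@[fun_prop]
theorem prodMk {g : α → γ} (hf : Poly O f) (hg : Poly O g) : Poly O fun a => (f a, g a) := by
  obtain ⟨ω, _, _, p, T, hT, h⟩ := hf
  obtain ⟨ω', _, _, p', T', hT', h'⟩ := hg
  let φ : Ix α ⊕ Ix β ⊕ ω → Ix α ⊕ (Ix β ⊕ Ix γ) ⊕ (ω ⊕ ω') :=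
    Sum.elim Sum.inl (Sum.elim (fun i => .inr (.inl (.inl i))) fun i => .inr (.inr (.inl i)))
  let ψ : Ix α ⊕ Ix γ ⊕ ω' → Ix α ⊕ (Ix β ⊕ Ix γ) ⊕ (ω ⊕ ω') :=
    Sum.elim Sum.inl (Sum.elim (fun i => .inr (.inl (.inr i))) fun i => .inr (.inr (.inr i)))
  refine ⟨ω ⊕ ω', inferInstance, inferInstance, .seq (p.map φ) (p'.map ψ),
    fun a => T a + T' a, hT.add hT', fun a => ?_⟩
  refine Runs.seq (s' := st (enc a) (Sum.elim (enc (f a)) nil) nil) (Runs.map ?_ ?_ ?_)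
    (Runs.map ?_ ?_ ?_)
  · rintro (i | i | i) (j | j | j) h <;> simp_all [φ]
  · convert h a using 1 <;> (funext i; rcases i with i | i | i <;> rfl)
  · rintro (i | (i | i) | (i | i)) hi
    · rfl
    · exact absurd rfl (hi (.inr (.inl i)))
    · rfl
    · rfl
    · rfl
  · rintro (i | i | i) (j | j | j) h <;> simp_all [ψ]
  · convert h' a using 1 <;> (funext i; rcases i with i | i | i <;> rfl)
  · rintro (i | (i | i) | (i | i)) hi
    · rfl
    · rfl
    · exact absurd rfl (hi (.inr (.inl i)))
    · rfl
    · rfl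

@[fun_prop]
theorem cond {c : α → Bool} {f g : α → β} (hc : Poly O c) (hf : Poly O f) (hg : Poly O g) :
    Poly O fun a => bif c a then f a else g a := by
  obtain ⟨ω, _, _, p, T, hT, h⟩ := hf
  obtain ⟨ω', _, _, p', T', hT', h'⟩ := hg
  obtain ⟨ω'', _, _, p'', T'', hT'', h''⟩ := hc
  let φ : Ix α ⊕ Ix β ⊕ ω → Ix α ⊕ Ix β ⊕ (Ix Bool ⊕ ω ⊕ ω' ⊕ ω'') :=
    Sum.elim Sum.inl (Sum.elim (fun i => .inr (.inl i)) fun i => .inr (.inr (.inr (.inl i))))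
  let φ' : Ix α ⊕ Ix β ⊕ ω' → Ix α ⊕ Ix β ⊕ (Ix Bool ⊕ ω ⊕ ω' ⊕ ω'') :=
    Sum.elim Sum.inl (Sum.elim (fun i => .inr (.inl i)) fun i => .inr (.inr (.inr (.inr (.inl i)))))
  let φ'' : Ix α ⊕ Ix Bool ⊕ ω'' → Ix α ⊕ Ix β ⊕ (Ix Bool ⊕ ω ⊕ ω' ⊕ ω'') :=
    Sum.elim Sum.inl
      (Sum.elim (fun i => .inr (.inr (.inl i))) fun i => .inr (.inr (.inr (.inr (.inr i)))))
  refine ⟨Ix Bool ⊕ ω ⊕ ω' ⊕ ω'', inferInstance, inferInstance,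
    .seq (p''.map φ'') (.case (.inr (.inr (.inl (() : Unit)))) .skip
      fun b => _root_.cond b (p.map φ) (p'.map φ')),
    fun a => T'' a + (1 + (T a + T' a)), hT''.add ((PolyBdd.const 1).add (hT.add hT')),
    fun a => ?_⟩
  refine Runs.seq (s' := st (enc a) nil (Sum.elim (enc (c a)) nil)) (Runs.map ?_ ?_ ?_)
    (Runs.case_cons (b := c a) (l := []) rfl ?_)
  · rintro (i | i | i) (j | j | j) h <;> simp [φ''] at h ⊢ <;> exact h
  · convert h'' a using 1 <;> (funext i; rcases i with i | i | i <;> rfl)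
  · rintro (i | i | i | i | i | i) hi
    · rfl
    · rfl
    · exact absurd rfl (hi (.inr (.inl i)))
    · rfl
    · rfl
    · rfl
  have e : update
      (st (enc a) nil (Sum.elim (enc (c a)) nil) : Ix α ⊕ Ix β ⊕ (Ix Bool ⊕ ω ⊕ ω' ⊕ ω'') → _)
      (.inr (.inr (.inl (() : Unit)))) [] = st (enc a) nil nil := by
    funext i
    rcases i with i | i | i | i
    · simp
    · simp
    · rw [show i = (() : Unit) from rfl]
      simp
    · simp
  rw [e]
  change Runs O _ _ _ (st (enc a) (enc (bif c a then f a else g a)) nil)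
  cases c a with
  | true =>
    refine (Runs.map (T := T a) ?_ ?_ ?_).mono (Nat.le_add_right _ _)
    · rintro (i | i | i) (j | j | j) h <;> simp [φ] at h ⊢ <;> exact h
    · convert h a using 1 <;> (funext i; rcases i with i | i | i <;> rfl)
    · rintro (i | i | i) hi
      · rfl
      · exact absurd rfl (hi (.inr (.inl i)))
      · rfl
  | false =>
    refine (Runs.map (T := T' a) ?_ ?_ ?_).mono (Nat.le_add_left _ _)
    · rintro (i | i | i) (j | j | j) h <;> simp [φ'] at h ⊢ <;> exact h
    · convert h' a using 1 <;> (funext i; rcases i with i | i | i <;> rfl)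
    · rintro (i | i | i) hi
      · rfl
      · exact absurd rfl (hi (.inr (.inl i)))
      · rfl

end Poly

end StackProgram

/-! ### Bounded iteration, words and calls of the oracle -/

namespace StackProgram

open Function Turing
variable {O : Oracle}
open Data (Ix enc)
variable {α β γ : Type} [Data α] [Data β] [Data γ]

namespace Poly

-- The index type of the stacks is a nested sum, for which instance search needs more room.
set_option synthInstance.maxSize 2000 in
/-- Bounded iteration: `n a` steps of a computable function form a computable function, provided
that the size of all intermediate results is polynomially bounded. -/
theorem iterate {init : α → β} {step : α × β → β} {n : α → ℕ} (hinit : Poly O init)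
    (hstep : Poly O step) (hn : Poly O n) {Q : α → ℕ} (hQ : PolyBdd Q)
    (hsize : ∀ a i, i ≤ n a → size ((fun b => step (a, b))^[i] (init a)) ≤ Q a) :
    Poly O fun a => (fun b => step (a, b))^[n a] (init a) := by
  have hns := hn.size_le
  obtain ⟨ω, _, _, p, T, hT, h⟩ := hinit
  obtain ⟨ω', _, _, p', T', ⟨P', hT'⟩, h'⟩ := hstep
  obtain ⟨ω'', _, _, p'', T'', hT'', h''⟩ := hn
  -- The output stacks hold the current value, `β'` receives the next one, `cnt` counts down the
  -- remaining rounds, and `tmp` serves to move stacks.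
  let β₀ : Ix β → Ix α ⊕ Ix β ⊕ (Ix β ⊕ Ix ℕ ⊕ Unit ⊕ ω ⊕ ω' ⊕ ω'') := fun i => .inr (.inl i)
  let β' : Ix β → Ix α ⊕ Ix β ⊕ (Ix β ⊕ Ix ℕ ⊕ Unit ⊕ ω ⊕ ω' ⊕ ω'') := fun i => .inr (.inr (.inl i))
  let cnt : Ix ℕ → Ix α ⊕ Ix β ⊕ (Ix β ⊕ Ix ℕ ⊕ Unit ⊕ ω ⊕ ω' ⊕ ω'') :=
    fun i => .inr (.inr (.inr (.inl i)))
  let tmp : Ix α ⊕ Ix β ⊕ (Ix β ⊕ Ix ℕ ⊕ Unit ⊕ ω ⊕ ω' ⊕ ω'') := .inr (.inr (.inr (.inr (.inl ()))))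
  let φ : Ix α ⊕ Ix β ⊕ ω → Ix α ⊕ Ix β ⊕ (Ix β ⊕ Ix ℕ ⊕ Unit ⊕ ω ⊕ ω' ⊕ ω'') :=
    Sum.elim Sum.inl (Sum.elim (fun i => .inr (.inl i))
      fun i => .inr (.inr (.inr (.inr (.inr (.inl i))))))
  let φ' : Ix (α × β) ⊕ Ix β ⊕ ω' → Ix α ⊕ Ix β ⊕ (Ix β ⊕ Ix ℕ ⊕ Unit ⊕ ω ⊕ ω' ⊕ ω'') :=
    Sum.elim (Sum.elim Sum.inl fun i => .inr (.inl i)) (Sum.elim β'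
      fun i => .inr (.inr (.inr (.inr (.inr (.inr (.inl i)))))))
  let φ'' : Ix α ⊕ Ix ℕ ⊕ ω'' → Ix α ⊕ Ix β ⊕ (Ix β ⊕ Ix ℕ ⊕ Unit ⊕ ω ⊕ ω' ⊕ ω'') :=
    Sum.elim Sum.inl (Sum.elim cnt
      fun i => .inr (.inr (.inr (.inr (.inr (.inr (.inr i)))))))
  let S : (Ix α → List Bool) → (Ix β → List Bool) → (Ix β → List Bool) → List Bool →
      (Ix α ⊕ Ix β ⊕ (Ix β ⊕ Ix ℕ ⊕ Unit ⊕ ω ⊕ ω' ⊕ ω'') → List Bool) := fun a b b' c =>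
    st a b (Sum.elim b' (Sum.elim (fun _ => c) nil))
  have hclear : ∀ a (b b' : β) (c : List Bool),
      Runs O (Prog.forAll fun i => .clear (β₀ i)) (S (enc a) (enc b) (enc b') c)
        (Fintype.card (Ix β) * (2 * size b + 1) + 1) (S (enc a) nil (enc b') c) := by
    intro a b b' c
    refine Runs.clearAll (φ := β₀) (fun i j h => by simpa [β₀] using h)
      (fun i => rfl) ?_ (fun i => length_enc_le b i)
    rintro (i | i | i) hi
    · rfl
    · exact absurd rfl (hi i)
    · rfl
  have htrans : ∀ a (b' : β) (c : List Bool),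
      Runs O (Prog.forAll fun i => .transfer (β' i) (β₀ i) tmp) (S (enc a) nil (enc b') c)
        (Fintype.card (Ix β) * (4 * size b' + 2) + 1) (S (enc a) (enc b') nil c) := by
    intro a b' c
    refine Runs.transferAll (φ := β') (ψ := β₀) (u := tmp)
      (fun i j h => by simpa [β'] using h) (fun i j h => by simpa [β₀] using h)
      (by simp [β', β₀]) (by simp [β', tmp]) (by simp [β₀, tmp]) rfl (fun i => rfl) (fun i => rfl)
      (fun i => rfl) ?_ (fun i => length_enc_le b' i)
    rintro (i | i | i | i | i) hi hi'
    · rfl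
    · exact absurd rfl (hi i)
    · exact absurd rfl (hi' i)
    · rfl
    · rfl
  have hst : ∀ a b c, Runs O (p'.map φ') (S (enc a) (enc b) nil c) (T' (a, b))
      (S (enc a) (enc b) (enc (step (a, b))) c) := by
    intro a b c
    refine Runs.map ?_ ?_ ?_
    · rintro ((i | i) | i | i) ((j | j) | j | j) h <;> simp [φ', β'] at h ⊢ <;>
        first | exact h | exact congrArg _ h
    · convert h' (a, b) using 1 <;> (funext i; rcases i with (i | i) | i | i <;> rfl)
    · rintro (i | i | i | i | i | i | i | i) hi
      · rfl
      · rfl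
      · exact absurd rfl (hi (.inr (.inl i)))
      all_goals rfl
  let B : Prog (Ix α ⊕ Ix β ⊕ (Ix β ⊕ Ix ℕ ⊕ Unit ⊕ ω ⊕ ω' ⊕ ω'')) := .seq (p'.map φ')
    (.seq (Prog.forAll fun i => .clear (β₀ i))
      (Prog.forAll fun i => .transfer (β' i) (β₀ i) tmp))
  let R : α → ℕ := fun a => P'.eval (size a + Q a) +
    ((Fintype.card (Ix β) * (2 * Q a + 1) + 1) + (Fintype.card (Ix β) * (4 * Q a + 2) + 1))
  have hbody : ∀ a (i : ℕ) c, i + 1 ≤ n a →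
      Runs O B (S (enc a) (enc ((fun b => step (a, b))^[i] (init a))) nil c) (R a)
        (S (enc a) (enc ((fun b => step (a, b))^[i + 1] (init a))) nil c) := by
    intro a i c hi
    rw [iterate_succ_apply']
    have h₁ := hsize a i (by omega)
    have h₂ := hsize a (i + 1) hi
    rw [iterate_succ_apply'] at h₂
    generalize (fun b => step (a, b))^[i] (init a) = b at *
    refine (((hst a b c).mono ((hT' _).trans (polynomial_eval_mono P' ?_))).seq
      (((hclear a b (step (a, b)) c).mono ?_).seq ((htrans a (step (a, b)) c).mono ?_)))
    · simp only [size_prod]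
      omega
    · gcongr
    · gcongr
  refine ⟨Ix β ⊕ Ix ℕ ⊕ Unit ⊕ ω ⊕ ω' ⊕ ω'', inferInstance, inferInstance,
    .seq (p.map φ) (.seq (p''.map φ'') (.loop (cnt (() : Unit)) fun _ => B)),
    fun a => T a + (T'' a + (n a * (R a + 1) + 1)), ?_, fun a => ?_⟩
  · have hn' : PolyBdd n := hns.mono fun a => (size_nat (n a)).ge
    refine hT.add (hT''.add ((hn'.mul (PolyBdd.add ?_ (.const 1))).add (.const 1)))
    have h₁ : ∀ m k, PolyBdd fun a => Fintype.card (Ix β) * (m * Q a + k) := fun m k =>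
      (PolyBdd.const _).mul (((PolyBdd.const m).mul hQ).add (.const k))
    exact ((PolyBdd.size.add hQ).eval P').add (((h₁ 2 1).add (.const 1)).add
      ((h₁ 4 2).add (.const 1)))
  · have h₁ : Runs O (p.map φ) (st (enc a) nil nil) (T a) (S (enc a) (enc (init a)) nil []) := by
      refine Runs.map ?_ ?_ ?_
      · rintro (i | i | i) (j | j | j) h <;> simp [φ] at h ⊢ <;> exact h
      · convert h a using 1 <;> (funext i; rcases i with i | i | i <;> rfl)
      · rintro (i | i | i | i | i | i | i | i) hi
        · rfl
        · exact absurd rfl (hi (.inr (.inl i)))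
        all_goals rfl
    have h₂ : Runs O (p''.map φ'') (S (enc a) (enc (init a)) nil []) (T'' a)
        (S (enc a) (enc (init a)) nil (List.replicate (n a) true)) := by
      refine Runs.map ?_ ?_ ?_
      · rintro (i | i | i) (j | j | j) h <;> simp [φ'', cnt] at h ⊢ <;> exact h
      · convert h'' a using 1 <;> (funext i; rcases i with i | i | i <;> rfl)
      · rintro (i | i | i | i | i | i | i | i) hi
        · rfl
        · rfl
        · rfl
        · exact absurd rfl (hi (.inr (.inl i)))
        all_goals rfl
    have h₃ := Runs.loop (O := O) (v := cnt (() : Unit)) (r := fun _ => B) (T := R a) (n := n a)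
      (J := fun d l => S (enc a) (enc ((fun b => step (a, b))^[d.length] (init a))) nil l)
      (fun d l => rfl) (fun d b l hd => by
        have e : ∀ x, update (S (enc a) (enc x) nil (b :: l)) (cnt (() : Unit)) l =
            S (enc a) (enc x) nil l := by
          intro x
          funext i
          rcases i with i | i | i | i | i
          · simp [cnt, S]
          · simp [cnt, S]
          · simp [cnt, S]
          · rw [show i = (() : Unit) from rfl]
            simp [cnt, S]
          · simp [cnt, S]
        rw [e]
        exact hbody a d.length l (by omega)) [] (List.replicate (n a) true) (by simp)
    simp only [List.length_replicate, List.reverse_replicate, List.append_nil] at h₃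
    convert h₁.seq (h₂.seq h₃) using 1
    funext i
    rcases i with i | i | i | i | i <;> rfl

@[fun_prop]
theorem const (b : β) : Poly O fun _ : α => b := by
  have key : ∀ (l : List Bool) (v : Ix α ⊕ Ix β ⊕ Unit)
      (s : Ix α ⊕ Ix β ⊕ Unit → List Bool), s v = [] →
      Runs O (l.foldr (fun b p => .seq p (.push v b)) (.skip : Prog (Ix α ⊕ Ix β ⊕ Unit))) s
        (l.length + 1) (update s v l) := by
    intro l v s hs
    induction l with
    | nil =>
      have e : update s v [] = s := by rw [← hs, update_eq_self]
      rw [e]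
      exact Runs.skip.mono (by simp)
    | cons b l ih =>
      exact (ih.seq (Runs.push_of_eq (by simp))).mono (by simp)
  refine ⟨Unit, inferInstance, inferInstance,
    Prog.forAll fun i => (enc b i).foldr (fun b p => .seq p (.push (.inr (.inl i)) b)) .skip,
    fun _ => Fintype.card (Ix β) * (size b + 1) + 1, .const _, fun a => ?_⟩
  have := Runs.forAll (O := O) (J := fun A => (st (enc a) (fun i => if i ∈ A then enc b i else [])
    nil : Ix α ⊕ Ix β ⊕ Unit → List Bool)) (T := size b + 1)
    (P := fun i => (enc b i).foldr (fun b p => .seq p (.push (.inr (.inl i)) b)) .skip) (by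
      intro A i hi
      convert (key (enc b i) (.inr (.inl i)) (st (enc a) (fun i => if i ∈ A then enc b i else [])
        nil) (by simp [hi])).mono (Nat.add_le_add_right (length_enc_le b i) 1) using 1
      funext j
      rcases j with j | j | j
      · simp
      · by_cases hj : j = i
        · subst hj; simp
        · simp [hj]
      · simp)
  simpa using this

/-- The case of `Poly.of_consume` for functions of a word, with a single work stack. -/
theorem of_word {f : α → List Bool} {g : List Bool → β} (hf : Poly O f)
    (q : Prog (Unit ⊕ Ix β ⊕ Unit)) {T : α → ℕ} (hT : PolyBdd T)
    (h : ∀ a, Runs O q (st (fun _ => f a) nil nil) (T a) (st nil (enc (g (f a))) nil)) :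
    Poly O fun a => g (f a) :=
  hf.of_consume (β := List Bool) q hT h

theorem length_polyBdd {f : α → List Bool} (hf : Poly O f) : PolyBdd fun a => (f a).length :=
  hf.size_le.mono fun _ => (size_word _).ge

/-- The contents of one input stack, one output stack and one work stack. -/
abbrev stW (x y z : List Bool) : Unit ⊕ Unit ⊕ Unit → List Bool :=
  st (fun _ => x) (fun _ => y) (fun _ => z)

theorem update_stW₁ (x y z l : List Bool) : update (stW x y z) (.inl ()) l = stW l y z := by
  funext i
  rcases i with i | i | i <;> simp

theorem update_stW₂ (x y z l : List Bool) : update (stW x y z) (.inr (.inl ())) l = stW x l z := by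
  funext i
  rcases i with i | i | i <;> simp

theorem runs_transfer (x y : List Bool) :
    Runs O (.transfer (.inl ()) (.inr (.inl ())) (.inr (.inr ()))) (stW x y [])
      (4 * x.length + 2) (stW [] (x ++ y) []) := by
  have := Runs.transfer (O := O) (stW x y []) (v := .inl ()) (w := .inr (.inl ()))
    (u := .inr (.inr ())) (by simp) (by simp) (by simp) rfl
  rwa [update_stW₁, update_stW₂] at this

@[fun_prop]
theorem cons {f : α → List Bool} (hf : Poly O f) (b : Bool) : Poly O fun a => b :: f a := by
  refine hf.of_word (g := fun l => b :: l)
    (.seq (.transfer (.inl ()) (.inr (.inl ())) (.inr (.inr ()))) (.push (.inr (.inl ())) b))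
    (((PolyBdd.const 4).mul hf.length_polyBdd).add (.const 3)) fun a => ?_
  refine ((runs_transfer (f a) []).seq Runs.push).mono' (by omega) ?_
  rw [update_stW₂]
  simp
  rfl

@[fun_prop]
theorem tail {f : α → List Bool} (hf : Poly O f) : Poly O fun a => (f a).tail := by
  refine hf.of_word (g := List.tail) (.case (.inl ()) .skip fun _ =>
    .transfer (.inl ()) (.inr (.inl ())) (.inr (.inr ())))
    (((PolyBdd.const 4).mul hf.length_polyBdd).add (.const 3)) fun a => ?_
  match f a with
  | [] => exact (Runs.case_nil rfl Runs.skip).mono (by simp)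
  | b :: l =>
    refine (Runs.case_cons (s := stW (b :: l) [] []) (b := b) (l := l) rfl
      (T := 4 * l.length + 2) ?_).mono (by simp; omega)
    rw [update_stW₁]
    exact (runs_transfer (O := O) l []).mono' le_rfl (by simp; rfl)

@[fun_prop]
theorem headD {f : α → List Bool} (hf : Poly O f) : Poly O fun a => (f a).headD false := by
  refine hf.of_word (g := fun l => l.headD false) (.case (.inl ()) (.push (.inr (.inl ())) false)
      fun b => .seq (.clear (.inl ())) (.push (.inr (.inl ())) b))
    (((PolyBdd.const 2).mul hf.length_polyBdd).add (.const 3)) fun a => ?_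
  match f a with
  | [] =>
    refine (Runs.case_nil (s := stW [] [] []) rfl
      (Runs.push (s := stW [] [] []))).mono' (by simp) ?_
    rw [update_stW₂]
    rfl
  | b :: l =>
    refine (Runs.case_cons (s := stW (b :: l) [] []) (b := b) (l := l) rfl
      (T := 2 * l.length + 1 + 1) ?_).mono (by simp; omega)
    rw [update_stW₁]
    refine (Runs.clear (stW l [] []) (.inl ())).seq (Runs.push_of_eq ?_)
    rw [update_stW₁, update_stW₂]
    rfl

theorem isEmpty {f : α → List Bool} (hf : Poly O f) : Poly O fun a => (f a).isEmpty := by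
  refine hf.of_word (g := fun l => l.isEmpty) (.case (.inl ()) (.push (.inr (.inl ())) true)
      fun _ => .seq (.clear (.inl ())) (.push (.inr (.inl ())) false))
    (((PolyBdd.const 2).mul hf.length_polyBdd).add (.const 3)) fun a => ?_
  match f a with
  | [] =>
    refine (Runs.case_nil (s := stW [] [] []) rfl
      (Runs.push (s := stW [] [] []))).mono' (by simp) ?_
    rw [update_stW₂]
    rfl
  | b :: l =>
    refine (Runs.case_cons (s := stW (b :: l) [] []) (b := b) (l := l) rfl
      (T := 2 * l.length + 1 + 1) ?_).mono (by simp; omega)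
    rw [update_stW₁]
    refine (Runs.clear (stW l [] []) (.inl ())).seq (Runs.push_of_eq ?_)
    rw [update_stW₁, update_stW₂]
    rfl

@[fun_prop]
theorem length {f : α → List Bool} (hf : Poly O f) : Poly O fun a => (f a).length := by
  refine hf.of_word (g := fun l => l.length) (.loop (.inl ()) fun _ => .push (.inr (.inl ())) true)
    ((hf.length_polyBdd.mul (.const 2)).add (.const 1)) fun a => ?_
  have := Runs.loop (O := O) (v := .inl ()) (r := fun _ => .push (.inr (.inl ())) true) (T := 1)
    (J := fun d l => stW l (List.replicate d.length true) []) (n := (f a).length) (fun d l => rfl)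
    (fun d b l _ => Runs.push_of_eq (by rw [update_stW₁, update_stW₂]; rfl)) [] (f a) (by simp)
  exact this.mono' le_rfl (by simp; rfl)

/-- A call of the oracle. The program hands over the word `f a` in reverse order, and receives the
answer in reverse order. -/
theorem call {f g : α → List Bool} (hf : Poly O f) {t : α → ℕ} (ht : PolyBdd t)
    (hg : PolyBdd fun a => (g a).length) (h : ∀ a, ∃ u ≤ t a, O.run (f a).reverse u (g a)) :
    Poly O fun a => (g a).reverse := by
  obtain ⟨ω, _, _, p, T, hT, h'⟩ := hf
  let φ : Ix α ⊕ Ix (List Bool) ⊕ ω → Ix α ⊕ Ix (List Bool) ⊕ (Ix (List Bool) ⊕ ω) :=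
    Sum.elim Sum.inl (Sum.elim (fun i => .inr (.inr (.inl i))) fun i => .inr (.inr (.inr i)))
  have hlen := (show Poly O f from ⟨ω, ‹_›, ‹_›, p, T, hT, h'⟩).length_polyBdd
  refine ⟨Ix (List Bool) ⊕ ω, inferInstance, inferInstance, .seq (p.map φ)
    (.call (.inr (.inr (.inl (() : Unit)))) (.inr (.inl (() : Unit)))),
    fun a => T a + ((f a).length + 1 + t a + ((g a).length + 1)),
    hT.add (((hlen.add (.const 1)).add ht).add (hg.add (.const 1))), fun a => ?_⟩
  obtain ⟨u, hu, h⟩ := h a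
  have h₁ : Runs O (p.map φ) (st (enc a) nil nil) (T a)
      (st (enc a) nil (Sum.elim (fun _ => f a) nil)) := by
    refine Runs.map ?_ ?_ ?_
    · rintro (i | i | i) (j | j | j) h <;> simp [φ] at h ⊢ <;> exact h
    · convert h' a using 1 <;> (funext i; rcases i with i | i | i <;> rfl)
    · rintro (i | i | i | i) hi
      · rfl
      · rfl
      · exact absurd rfl (hi (.inr (.inl i)))
      · rfl
  refine h₁.seq ⟨(f a).length + 1 + u + ((g a).length + 1), by omega, ?_⟩
  have h₂ := Exec.call (O := O)
    (v := (.inr (.inr (.inl (() : Unit))) : Ix α ⊕ Ix (List Bool) ⊕ (Ix (List Bool) ⊕ ω)))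
    (w := .inr (.inl (() : Unit)))
    (s := (st (enc a) nil (Sum.elim (fun _ => f a) nil) :
      Ix α ⊕ Ix (List Bool) ⊕ (Ix (List Bool) ⊕ ω) → List Bool)) (t := u) (out := g a) h
  convert h₂ using 1
  · rfl
  funext i
  rcases i with i | i | i | i
  · rw [update_of_ne Sum.inl_ne_inr, update_of_ne Sum.inl_ne_inr]
    rfl
  · rw [show i = (() : Unit) from rfl, update_self,
      update_of_ne (Sum.inr_injective.ne Sum.inl_ne_inr)]
    exact (List.append_nil _).symm
  · rw [show i = (() : Unit) from rfl, update_of_ne (Sum.inr_injective.ne Sum.inr_ne_inl),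
      update_self]
    rfl
  · rw [update_of_ne (Sum.inr_injective.ne Sum.inr_ne_inl),
      update_of_ne (Sum.inr_injective.ne (Sum.inr_injective.ne Sum.inr_ne_inl))]
    rfl

/-- Computable decision procedures yield Turing machines; the input stack is cleared at the end. -/
theorem nonempty_tm2 {tm : FinTM2} {inp : tm.Γ tm.k₀ ≃ Bool} {outp : tm.Γ tm.k₁ ≃ Bool}
    {f : List Bool → Bool} (hf : Poly (machineOracle inp outp) f) {A B : Type}
    {ea : A → List Bool} {eb : B → List Bool} {F : A → B} (h : ∀ a, eb (F a) = [f (ea a)]) :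
    Nonempty (TM2ComputableInPolyTime ea eb F) := by
  obtain ⟨ω, _, _, p, T, ⟨P, hT⟩, hp⟩ := hf
  refine nonempty_polyTime_of_exec (inp := inp) (outp := outp)
    (.seq p (.clear (.inl (() : Unit)))) (.inl (() : Unit))
    (.inr (.inl (() : Unit))) (P + (2 * Polynomial.X + 1)) fun a => ?_
  have h₁ := (hp (ea a)).seq (Runs.clear _ (.inl (() : Unit)))
  have e : (P + (2 * Polynomial.X + 1)).eval (ea a).length =
      P.eval (ea a).length + (2 * (ea a).length + 1) := by simp
  rw [e]
  have e₁ : update (fun _ => []) (.inl (() : Unit)) (ea a) =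
      (st (enc (ea a)) nil nil : Ix (List Bool) ⊕ Ix Bool ⊕ ω → List Bool) := by
    funext i
    rcases i with i | i | i
    · exact update_self _ _ _
    · exact update_of_ne Sum.inr_ne_inl _ _
    · exact update_of_ne Sum.inr_ne_inl _ _
  have e₂ : update (st (enc (ea a)) (enc (f (ea a))) nil) (.inl (() : Unit)) [] =
      (update (fun _ => []) (.inr (.inl (() : Unit))) (eb (F a)) :
        Ix (List Bool) ⊕ Ix Bool ⊕ ω → List Bool) := by
    rw [h]
    funext i
    rcases i with i | i | i
    · rw [update_of_ne Sum.inl_ne_inr]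
      exact update_self _ _ _
    · refine (update_of_ne Sum.inr_ne_inl _ _).trans ?_
      rw [show i = (() : Unit) from rfl, update_self]
      rfl
    · rw [update_of_ne Sum.inr_ne_inl, update_of_ne (Sum.inr_injective.ne Sum.inr_ne_inl)]
      rfl
  rw [e₁]
  refine h₁.mono' (Nat.add_le_add ((hT _).trans ?_) le_rfl) e₂
  rw [size_word]

/-! ### Arithmetic -/

@[fun_prop]
theorem id' : Poly O fun a : α => a := of_reindex (fun i => i) fun _ _ => rfl

@[fun_prop]
theorem fst' {f : α → β × γ} (hf : Poly O f) : Poly O fun a => (f a).1 :=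
  Poly.comp (g := Prod.fst) (of_reindex Sum.inl fun _ _ => rfl) hf

@[fun_prop]
theorem snd' {f : α → β × γ} (hf : Poly O f) : Poly O fun a => (f a).2 :=
  Poly.comp (g := Prod.snd) (of_reindex Sum.inr fun _ _ => rfl) hf

theorem nat_bdd {f : α → ℕ} (hf : Poly O f) : PolyBdd f :=
  hf.size_le.mono fun a => (size_nat (f a)).ge

theorem replicate {n : α → ℕ} (hn : Poly O n) : Poly O fun a => List.replicate (n a) true :=
  Poly.comp (g := fun n : ℕ => List.replicate n true) (of_reindex (fun i => i) fun _ _ => rfl) hn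

theorem succ {n : α → ℕ} (hn : Poly O n) : Poly O fun a => n a + 1 := by
  simpa using (hn.replicate.cons true).length

theorem pred {n : α → ℕ} (hn : Poly O n) : Poly O fun a => n a - 1 := by
  simpa using hn.replicate.tail.length

theorem isZero {n : α → ℕ} (hn : Poly O n) : Poly O fun a => decide (n a = 0) := by
  have := hn.replicate.isEmpty
  refine cast (congrArg _ (funext fun a => ?_)) this
  cases n a <;> simp [List.replicate_succ]

/-- Primitive recursion along a natural number, with polynomially bounded intermediate results. -/
theorem natRec {n : α → ℕ} {init : α → β} {step : α → ℕ → β → β} (hn : Poly O n)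
    (hinit : Poly O init) (hstep : Poly O fun x : α × ℕ × β => step x.1 x.2.1 x.2.2)
    {Q : α → ℕ} (hQ : PolyBdd Q)
    (hsize : ∀ a i, i ≤ n a → size (Nat.rec (init a) (step a) i : β) ≤ Q a) :
    Poly O fun a => (Nat.rec (init a) (step a) (n a) : β) := by
  have key : ∀ a i, (fun s : ℕ × β => (s.1 + 1, step a s.1 s.2))^[i] (0, init a) =
      (i, (Nat.rec (init a) (step a) i : β)) := by
    intro a i
    induction i with
    | zero => rfl
    | succ i ih => rw [iterate_succ_apply', ih]
  have h := Poly.iterate (O := O) (init := fun a => (0, init a))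
    (step := fun x : α × ℕ × β => (x.2.1 + 1, step x.1 x.2.1 x.2.2)) (n := n)
    ((const 0).prodMk hinit) ((by fun_prop : Poly O fun x : α × ℕ × β => x.2.1).succ.prodMk hstep)
    hn (hn.nat_bdd.add hQ) (fun a i hi => by
      simp only [key, size_prod, size_nat]
      exact add_le_add hi (hsize a i hi))
  simp only [key] at h
  exact h.snd'

@[fun_prop]
theorem add {m n : α → ℕ} (hm : Poly O m) (hn : Poly O n) : Poly O fun a => m a + n a := by
  have h := natRec (O := O) (n := n) (init := m) (step := fun _ _ x => x + 1) hn hm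
    ((by fun_prop : Poly O fun x : α × ℕ × ℕ => x.2.2).succ) (hm.nat_bdd.add hn.nat_bdd)
  have key : ∀ a i, (Nat.rec (m a) (fun _ x => x + 1) i : ℕ) = m a + i := by
    intro a i
    induction i with
    | zero => rfl
    | succ i ih => simp only [ih]; ring
  simp only [key, size_nat] at h
  exact h fun a i hi => by omega

@[fun_prop]
theorem sub {m n : α → ℕ} (hm : Poly O m) (hn : Poly O n) : Poly O fun a => m a - n a := by
  have h := natRec (O := O) (n := n) (init := m) (step := fun _ _ x => x - 1) hn hm
    ((by fun_prop : Poly O fun x : α × ℕ × ℕ => x.2.2).pred) hm.nat_bdd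
  have key : ∀ a i, (Nat.rec (m a) (fun _ x => x - 1) i : ℕ) = m a - i := by
    intro a i
    induction i with
    | zero => rfl
    | succ i ih => simp only [ih]; omega
  simp only [key, size_nat] at h
  exact h fun a i hi => by omega

@[fun_prop]
theorem mul {m n : α → ℕ} (hm : Poly O m) (hn : Poly O n) : Poly O fun a => m a * n a := by
  have h := natRec (O := O) (n := n) (init := fun _ => 0) (step := fun a _ x => x + m a) hn
    (const 0) (by fun_prop) (hm.nat_bdd.mul hn.nat_bdd)
  have key : ∀ a i, (Nat.rec 0 (fun _ x => x + m a) i : ℕ) = m a * i := by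
    intro a i
    induction i with
    | zero => rfl
    | succ i ih => simp only [ih]; ring
  simp only [key, size_nat] at h
  exact h fun a i hi => Nat.mul_le_mul le_rfl hi

end Poly

/-! ### Tests, bounded search and tables -/

@[fun_prop]
theorem poly_not {p : α → Bool} (hp : Poly O p) : Poly O fun a => !p a := by
  have : Poly O fun a => bif p a then false else true := by fun_prop
  refine cast (congrArg _ (funext fun a => ?_)) this
  cases p a <;> rfl

@[fun_prop]
theorem poly_and {p q : α → Bool} (hp : Poly O p) (hq : Poly O q) : Poly O fun a => p a && q a := by
  have : Poly O fun a => bif p a then q a else false := by fun_prop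
  refine cast (congrArg _ (funext fun a => ?_)) this
  cases p a <;> rfl

@[fun_prop]
theorem poly_or {p q : α → Bool} (hp : Poly O p) (hq : Poly O q) : Poly O fun a => p a || q a := by
  have : Poly O fun a => bif p a then true else q a := by fun_prop
  refine cast (congrArg _ (funext fun a => ?_)) this
  cases p a <;> rfl

@[fun_prop]
theorem poly_ble {m n : α → ℕ} (hm : Poly O m) (hn : Poly O n) :
    Poly O fun a => Nat.ble (m a) (n a) := by
  have := (hm.sub hn).isZero
  refine cast (congrArg _ (funext fun a => ?_)) this
  rw [Bool.eq_iff_iff]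
  simp only [decide_eq_true_eq, Nat.ble_eq]
  omega

@[fun_prop]
theorem poly_beq {m n : α → ℕ} (hm : Poly O m) (hn : Poly O n) :
    Poly O fun a => Nat.beq (m a) (n a) := by
  have : Poly O fun a => Nat.ble (m a) (n a) && Nat.ble (n a) (m a) := by fun_prop
  refine cast (congrArg _ (funext fun a => ?_)) this
  rw [Bool.eq_iff_iff]
  simp only [Bool.and_eq_true, Nat.ble_eq, Nat.beq_eq]
  omega

@[fun_prop]
theorem poly_pow_const {n : α → ℕ} (hn : Poly O n) (k : ℕ) : Poly O fun a => n a ^ k := by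
  induction k with
  | zero => simpa using Poly.const 1
  | succ k ih =>
    simp only [pow_succ]
    fun_prop

/-- Whether `P i` for some `i < n`. -/
def anyBelow (n : ℕ) (P : ℕ → Bool) : Bool := Nat.rec false (fun i b => P i || b) n

@[simp] theorem anyBelow_iff {n : ℕ} {P : ℕ → Bool} :
    anyBelow n P = true ↔ ∃ i < n, P i = true := by
  induction n with
  | zero => simp [anyBelow]
  | succ n ih =>
    change (P n || anyBelow n P) = true ↔ _
    rw [Bool.or_eq_true, ih]
    constructor
    · rintro (h | ⟨i, hi, h⟩)
      · exact ⟨n, by omega, h⟩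
      · exact ⟨i, by omega, h⟩
    · rintro ⟨i, hi, h⟩
      rcases Nat.lt_succ_iff_lt_or_eq.1 hi with hi | rfl
      · exact Or.inr ⟨i, hi, h⟩
      · exact Or.inl h

@[fun_prop]
theorem poly_anyBelow {n : α → ℕ} {P : α → ℕ → Bool} (hn : Poly O n)
    (hP : Poly O fun x : α × ℕ => P x.1 x.2) : Poly O fun a => anyBelow (n a) (P a) := by
  refine Poly.natRec (init := fun _ => false) (step := fun a i b => P a i || b) hn (by fun_prop)
    ?_ (PolyBdd.const 1) (by simp)
  have : Poly O fun x : α × ℕ × Bool => P x.1 x.2.1 :=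
    hP.comp (f := fun x : α × ℕ × Bool => (x.1, x.2.1)) (by fun_prop)
  fun_prop

/-- Whether `P i` for all `i < n`. -/
def allBelow (n : ℕ) (P : ℕ → Bool) : Bool := !anyBelow n fun i => !P i

@[simp] theorem allBelow_iff {n : ℕ} {P : ℕ → Bool} :
    allBelow n P = true ↔ ∀ i < n, P i = true := by
  rw [allBelow, Bool.not_eq_true', ← Bool.not_eq_true, anyBelow_iff]
  simp

@[fun_prop]
theorem poly_allBelow {n : α → ℕ} {P : α → ℕ → Bool} (hn : Poly O n)
    (hP : Poly O fun x : α × ℕ => P x.1 x.2) : Poly O fun a => allBelow (n a) (P a) := by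
  unfold allBelow
  fun_prop

/-- The number of `i < n` with `P i`. -/
def countBelow (n : ℕ) (P : ℕ → Bool) : ℕ :=
  Nat.rec 0 (fun i c => bif P i then c + 1 else c) n

theorem countBelow_eq (n : ℕ) (P : ℕ → Bool) :
    countBelow n P = ((Finset.range n).filter fun i => P i = true).card := by
  induction n with
  | zero => rfl
  | succ n ih =>
    change (bif P n then countBelow n P + 1 else countBelow n P) = _
    rw [Finset.range_add_one, Finset.filter_insert, ih]
    cases P n <;> simp

@[fun_prop]
theorem poly_countBelow {n : α → ℕ} {P : α → ℕ → Bool} (hn : Poly O n)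
    (hP : Poly O fun x : α × ℕ => P x.1 x.2) : Poly O fun a => countBelow (n a) (P a) := by
  refine Poly.natRec (init := fun _ => 0) (step := fun a i c => bif P a i then c + 1 else c)
    hn (by fun_prop) ?_ hn.nat_bdd fun a i hi => ?_
  · have : Poly O fun x : α × ℕ × ℕ => P x.1 x.2.1 :=
      hP.comp (f := fun x : α × ℕ × ℕ => (x.1, x.2.1)) (by fun_prop)
    fun_prop
  · change size (countBelow i (P a)) ≤ n a
    rw [size_nat, countBelow_eq]
    exact (Finset.card_filter_le _ _).trans (by simpa using hi)

/-- The bit at position `i` of a word, and `false` beyond its end. -/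
def bitAt (l : List Bool) (i : ℕ) : Bool := l.getD i false

@[fun_prop]
theorem poly_bitAt {l : α → List Bool} {n : α → ℕ} (hl : Poly O l) (hn : Poly O n) :
    Poly O fun a => bitAt (l a) (n a) := by
  have key : ∀ (l : List Bool) i, (Nat.rec l (fun _ l => l.tail) i : List Bool) = l.drop i := by
    intro l i
    induction i with
    | zero => rfl
    | succ i ih => simp only [ih, List.tail_drop]
  have h := Poly.natRec (O := O) (init := l) (step := fun _ _ l => l.tail) hn hl (by fun_prop)
    hl.length_polyBdd (fun a i _ => by simp [key])
  simp only [key] at h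
  refine cast (congrArg _ (funext fun a => ?_)) h.headD
  simp [bitAt, List.headD_eq_head?_getD, List.getD_eq_getElem?_getD]

/-- The word `g (n - 1), …, g 0`, in the order in which a stack is filled. -/
def table (n : ℕ) (g : ℕ → Bool) : List Bool := Nat.rec [] (fun i l => g i :: l) n

theorem length_table (n : ℕ) (g : ℕ → Bool) : (table n g).length = n := by
  induction n with
  | zero => rfl
  | succ n ih => exact congrArg (· + 1) ih

theorem bitAt_table {n : ℕ} (g : ℕ → Bool) {i : ℕ} (hi : i < n) :
    bitAt (table n g) (n - 1 - i) = g i := by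
  induction n with
  | zero => omega
  | succ n ih =>
    rcases Nat.lt_succ_iff_lt_or_eq.1 hi with hi | rfl
    · have : n + 1 - 1 - i = n - 1 - i + 1 := by omega
      rw [this]
      exact ih hi
    · simp [table, bitAt]

@[fun_prop]
theorem poly_table {n : α → ℕ} {g : α → ℕ → Bool} (hn : Poly O n)
    (hg : Poly O fun x : α × ℕ => g x.1 x.2) : Poly O fun a => table (n a) (g a) := by
  refine Poly.natRec (init := fun _ => []) (step := fun a i l => g a i :: l) hn (by fun_prop)
    ?_ hn.nat_bdd fun a i hi => ?_
  · have : Poly O fun x : α × ℕ × List Bool => g x.1 x.2.1 :=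
      hg.comp (f := fun x : α × ℕ × List Bool => (x.1, x.2.1)) (by fun_prop)
    have : Poly O fun x : α × ℕ × List Bool =>
        bif g x.1 x.2.1 then true :: x.2.2 else false :: x.2.2 := by fun_prop
    refine cast (congrArg _ (funext fun a => ?_)) this
    cases g a.1 a.2.1 <;> rfl
  · change size (table i (g a)) ≤ n a
    rw [size_word, length_table]
    exact hi

/-- Dynamic programming: starting from the table of `g`, computes in `n` rounds new tables of length
`N`, the entries of each by `F` from the number of the round and the previous table. -/
def iterTable (N : ℕ) (g : ℕ → Bool) (F : ℕ → List Bool → ℕ → Bool) (n : ℕ) : List Bool :=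
  Nat.rec (table N g) (fun i l => table N (F i l)) n

@[fun_prop]
theorem poly_iterTable {N n : α → ℕ} {g : α → ℕ → Bool} {F : α → ℕ → List Bool → ℕ → Bool}
    (hN : Poly O N) (hn : Poly O n) (hg : Poly O fun x : α × ℕ => g x.1 x.2)
    (hF : Poly O fun x : α × ℕ × List Bool × ℕ => F x.1 x.2.1 x.2.2.1 x.2.2.2) :
    Poly O fun a => iterTable (N a) (g a) (F a) (n a) := by
  refine Poly.natRec (init := fun a => table (N a) (g a))
    (step := fun a i l => table (N a) (F a i l)) hn (by fun_prop) ?_ hN.nat_bdd fun a i hi => ?_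
  · have : Poly O fun y : (α × ℕ × List Bool) × ℕ => F y.1.1 y.1.2.1 y.1.2.2 y.2 :=
      hF.comp (f := fun y : (α × ℕ × List Bool) × ℕ => (y.1.1, y.1.2.1, y.1.2.2, y.2)) (by fun_prop)
    exact poly_table (n := fun x : α × ℕ × List Bool => N x.1)
      (g := fun x : α × ℕ × List Bool => F x.1 x.2.1 x.2.2) (by fun_prop) this
  · cases i <;> simp [length_table]

/-! ### Search over tuples of fixed length -/

@[fun_prop]
theorem poly_apply {k : ℕ} (j : Fin k) : Poly O fun v : Fin k → ℕ => v j :=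
  Poly.of_reindex (fun i => (j, i)) fun _ _ => rfl

theorem poly_finCons {k : ℕ} {n : α → ℕ} {v : α → Fin k → ℕ} (hn : Poly O n) (hv : Poly O v) :
    Poly O fun a => (Fin.cons (n a) (v a) : Fin (k + 1) → ℕ) := by
  refine Poly.comp (g := fun x : ℕ × (Fin k → ℕ) => (Fin.cons x.1 x.2 : Fin (k + 1) → ℕ))
    (Poly.of_reindex (fun i => Fin.cases (Sum.inl i.2) (fun j => Sum.inr (j, i.2)) i.1) ?_)
    (hn.prodMk hv)
  rintro x ⟨i, u⟩
  induction i using Fin.cases <;> rfl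

/-- Whether `P v` for some tuple `v` of `k` numbers below `n`. For fixed `k` this is a polynomial
number of tests. -/
def anyTuple : (k : ℕ) → ℕ → ((Fin k → ℕ) → Bool) → Bool
  | 0, _, P => P Fin.elim0
  | k + 1, n, P => anyBelow n fun i => anyTuple k n fun v => P (Fin.cons i v)

@[simp] theorem anyTuple_iff {k n : ℕ} {P : (Fin k → ℕ) → Bool} :
    anyTuple k n P = true ↔ ∃ v, (∀ j, v j < n) ∧ P v = true := by
  induction k with
  | zero =>
    refine ⟨fun h => ⟨Fin.elim0, fun j => j.elim0, h⟩, fun ⟨v, _, h⟩ => ?_⟩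
    rwa [Subsingleton.elim v Fin.elim0] at h
  | succ k ih =>
    simp only [anyTuple, anyBelow_iff, ih]
    constructor
    · rintro ⟨i, hi, v, hv, h⟩
      exact ⟨Fin.cons i v, Fin.cases hi hv, h⟩
    · rintro ⟨v, hv, h⟩
      exact ⟨v 0, hv 0, Fin.tail v, fun j => hv j.succ, by rwa [Fin.cons_self_tail]⟩

@[fun_prop]
theorem poly_anyTuple {k : ℕ} {n : α → ℕ} {P : α → (Fin k → ℕ) → Bool} (hn : Poly O n)
    (hP : Poly O fun x : α × (Fin k → ℕ) => P x.1 x.2) :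
    Poly O fun a => anyTuple k (n a) (P a) := by
  induction k generalizing α with
  | zero => exact hP.comp (f := fun a => (a, Fin.elim0)) (by fun_prop)
  | succ k ih =>
    refine poly_anyBelow hn (P := fun a i => anyTuple k (n a) fun v => P a (Fin.cons i v)) ?_
    refine ih (n := fun x : α × ℕ => n x.1) (P := fun x v => P x.1 (Fin.cons x.2 v))
      (by fun_prop) ?_
    exact hP.comp (f := fun y : (α × ℕ) × (Fin k → ℕ) =>
      (y.1.1, (Fin.cons y.1.2 y.2 : Fin (k + 1) → ℕ)))
      (Poly.prodMk (by fun_prop) (poly_finCons (by fun_prop) (by fun_prop)))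

@[fun_prop]
theorem poly_listAll {ι : Type} (l : List ι) {P : α → ι → Bool}
    (hP : ∀ i, Poly O fun a => P a i) : Poly O fun a => l.all (P a) := by
  induction l with
  | nil => simpa using Poly.const true
  | cons i l ih =>
    simp only [List.all_cons]
    have := hP i
    fun_prop

@[fun_prop]
theorem poly_listAny {ι : Type} (l : List ι) {P : α → ι → Bool}
    (hP : ∀ i, Poly O fun a => P a i) : Poly O fun a => l.any (P a) := by
  induction l with
  | nil => simpa using Poly.const false
  | cons i l ih =>
    simp only [List.any_cons]
    have := hP i
    fun_prop

@[fun_prop]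
theorem poly_sum {k : ℕ} {f : α → Fin k → ℕ} (hf : ∀ i, Poly O fun a => f a i) :
    Poly O fun a => ∑ i, f a i := by
  induction k with
  | zero => simpa using Poly.const 0
  | succ k ih =>
    simp only [Fin.sum_univ_succ]
    have := ih (f := fun a i => f a i.succ) fun i => hf _
    have := hf 0
    fun_prop

end StackProgram

namespace RankVoting

open Finset

/-! ### Positions in a linear order -/

section Position

variable {m : ℕ} {T : Fin m → Fin m → Prop}

theorem position_le_card (T : Fin m → Fin m → Prop) (x : Fin m) : position T x ≤ m :=
  (card_le_univ _).trans (Fintype.card_fin m).le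

theorem one_le_position (hT : IsLinearOrder (Fin m) T) (x : Fin m) : 1 ≤ position T x := by
  classical
  refine card_pos.2 ⟨x, ?_⟩
  simp only [mem_filter, mem_univ, true_and]
  exact hT.refl x

theorem position_mono (hT : IsLinearOrder (Fin m) T) {x y : Fin m} (h : T x y) :
    position T x ≤ position T y := by
  classical
  refine card_le_card fun z hz => ?_
  simp only [mem_filter, mem_univ, true_and] at hz ⊢
  exact hT.trans _ _ _ hz h

theorem position_injective (hT : IsLinearOrder (Fin m) T) : Function.Injective (position T) := by
  classical
  have key : ∀ x y, T x y → position T x = position T y → x = y := by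
    intro x y h e
    have hs : (univ.filter fun d => T d x) = univ.filter fun d => T d y :=
      eq_of_subset_of_card_le (fun z hz => by
        simp only [mem_filter, mem_univ, true_and] at hz ⊢
        exact hT.trans _ _ _ hz h) e.ge
    have : y ∈ univ.filter fun d => T d x := by
      rw [hs]
      simp only [mem_filter, mem_univ, true_and]
      exact hT.refl y
    simp only [mem_filter, mem_univ, true_and] at this
    exact hT.antisymm _ _ h this
  intro x y e
  rcases hT.total x y with h | h
  · exact key x y h e
  · exact (key y x h e.symm).symm

theorem card_le_of_position (hT : IsLinearOrder (Fin m) T) (s : Finset (Fin m)) {a b : ℕ}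
    (h : ∀ x ∈ s, a ≤ position T x ∧ position T x ≤ b) : s.card ≤ b + 1 - a := by
  rw [← Nat.card_Icc]
  exact card_le_card_of_injOn (position T) (fun x hx => by simpa using h x hx)
    (position_injective hT).injOn

end Position

/-! ### Linear extensions with prescribed bounds on positions -/

section Schedule

variable {m k : ℕ}

open scoped Classical in
/-- The candidates that must be among the first `t` positions if each `D d` is to be at position
`p d` or above: those that are preferred to some `D d` with `p d ≤ t`. -/
noncomputable def forced (P : Fin m → Fin m → Prop) (D : Fin k → Fin m) (p : Fin k → ℕ) (t : ℕ) :
    Finset (Fin m) :=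
  univ.filter fun x => ∃ d, p d ≤ t ∧ P x (D d)

open scoped Classical in
/-- The candidates that cannot be above `c`, including `c`. -/
noncomputable def below (P : Fin m → Fin m → Prop) (c : Fin m) : Finset (Fin m) :=
  univ.filter fun x => P c x

@[simp] theorem mem_forced {P : Fin m → Fin m → Prop} {D : Fin k → Fin m} {p : Fin k → ℕ} {t : ℕ}
    {x : Fin m} : x ∈ forced P D p t ↔ ∃ d, p d ≤ t ∧ P x (D d) := by simp [forced]

@[simp] theorem mem_below {P : Fin m → Fin m → Prop} {c x : Fin m} : x ∈ below P c ↔ P c x := by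
  simp [below]

/-- The counting conditions for `P` to have a linear extension with `c` at position `q` or below
and every `D d` at position `p d` or above. The candidates in `below P c` then have positions in
`[q, m]`, those in `forced P D p t` in `[1, t]`, and those in both in `[q, t]`; each of these
intervals must be large enough. -/
def Feasible (P : Fin m → Fin m → Prop) (c : Fin m) (D : Fin k → Fin m) (q : ℕ)
    (p : Fin k → ℕ) : Prop :=
  (below P c).card + q ≤ m + 1 ∧ ∀ t < m + 1, (forced P D p t).card ≤ t ∧
    ((forced P D p t ∩ below P c).card = 0 ∨ (forced P D p t ∩ below P c).card + q ≤ t + 1)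

theorem feasible_of_linearOrder {P T : Fin m → Fin m → Prop} {c : Fin m} {D : Fin k → Fin m}
    {q : ℕ} {p : Fin k → ℕ} (hP : IsPartialOrder (Fin m) P) (hT : IsLinearOrder (Fin m) T)
    (hPT : ∀ a b, P a b → T a b)
    (hq : q ≤ position T c) (hp : ∀ d, position T (D d) ≤ p d) : Feasible P c D q p := by
  have hU : ∀ x ∈ below P c, q ≤ position T x := fun x hx =>
    hq.trans (position_mono hT (hPT _ _ (mem_below.1 hx)))
  have hL : ∀ t, ∀ x ∈ forced P D p t, position T x ≤ t := by
    intro t x hx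
    obtain ⟨d, hd, hx⟩ := mem_forced.1 hx
    exact (position_mono hT (hPT _ _ hx)).trans ((hp d).trans hd)
  refine ⟨?_, fun t _ => ⟨?_, ?_⟩⟩
  · have h₁ := card_le_of_position hT (below P c)
      (fun x hx => ⟨hU x hx, position_le_card T x⟩)
    have h₂ : 0 < (below P c).card := card_pos.2 ⟨c, mem_below.2 (hP.refl c)⟩
    omega
  · have := card_le_of_position hT (forced P D p t)
      (fun x hx => ⟨one_le_position hT x, hL t x hx⟩)
    omega
  · have := card_le_of_position hT (forced P D p t ∩ below P c)
      (fun x hx => ⟨hU x (mem_inter.1 hx).2, hL t x (mem_inter.1 hx).1⟩)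
    omega

/-- The `n` elements of `A` at which `g` is smallest. -/
theorem exists_initial_segment {ι : Type} [DecidableEq ι] (A : Finset ι) {g : ι → ℕ}
    (hg : Function.Injective g) {n : ℕ} (hn : n ≤ A.card) :
    ∃ F ⊆ A, F.card = n ∧ ∀ x ∈ F, ∀ y ∈ A, y ∉ F → g x < g y := by
  induction n with
  | zero => exact ⟨∅, by simp, rfl, by simp⟩
  | succ n ih =>
    obtain ⟨F, hFA, hF, h⟩ := ih (by omega)
    have hne : (A \ F).Nonempty := by
      rw [← card_pos, card_sdiff_of_subset hFA]
      omega
    obtain ⟨z, hz, hmin⟩ := exists_min_image (A \ F) g hne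
    rw [mem_sdiff] at hz
    refine ⟨insert z F, insert_subset hz.1 hFA, by rw [card_insert_of_notMem hz.2, hF], ?_⟩
    intro x hx y hy hyF
    rw [mem_insert, not_or] at hyF
    rcases mem_insert.1 hx with rfl | hx
    · exact lt_of_le_of_ne (hmin y (mem_sdiff.2 ⟨hy, hyF.2⟩)) fun e => hyF.1 (hg e).symm
    · exact h x hx y hy hyF.2

/-- The counting conditions are sufficient. This is scheduling by earliest deadline: the deadline
of a candidate `x` is the least `p d` such that `x` must not be below `D d`. The first `q - 1`
positions go to the candidates outside `below P c` that have the earliest deadlines, and all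
others follow in the order of their deadlines, with ties broken by a fixed linear extension of
`P`. -/
theorem Feasible.exists_linearOrder {P : Fin m → Fin m → Prop} {c : Fin m} {D : Fin k → Fin m}
    {q : ℕ} {p : Fin k → ℕ} (hP : IsPartialOrder (Fin m) P) (hq : 1 ≤ q) (hp : ∀ d, p d ≤ m)
    (h : Feasible P c D q p) :
    ∃ T, IsLinearOrder (Fin m) T ∧ (∀ a b, P a b → T a b) ∧ q ≤ position T c ∧
      ∀ d, position T (D d) ≤ p d := by
  classical
  obtain ⟨T₀, hT₀, hPT₀⟩ := extend_partialOrder P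
  -- `e x` is the deadline of `x`, and `m + 1` if there is none.
  let e : Fin m → ℕ := fun x => ((univ.filter fun d => P x (D d)).image p ∪ {m + 1}).min'
    ⟨m + 1, by simp⟩
  have he : ∀ x t, t ≤ m → (e x ≤ t ↔ x ∈ forced P D p t) := by
    intro x t ht
    rw [mem_forced]
    constructor
    · intro hbt
      have hb : e x ∈ _ := min'_mem _ _
      revert hb hbt
      generalize e x = b
      intro hbt hb
      simp only [mem_union, mem_image, mem_filter, mem_univ, true_and, mem_singleton] at hb
      rcases hb with ⟨d, hd, rfl⟩ | rfl
      · exact ⟨d, hbt, hd⟩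
      · omega
    · rintro ⟨d, hd, hx⟩
      refine (min'_le _ (p d) ?_).trans hd
      simp only [mem_union, mem_image, mem_filter, mem_univ, true_and, mem_singleton]
      exact Or.inl ⟨d, hx, rfl⟩
  have hemono : ∀ x y, P x y → e x ≤ e y := by
    intro x y hxy
    refine Finset.min'_subset _ (union_subset_union (image_subset_image ?_) subset_rfl)
    intro d hd
    simp only [mem_filter, mem_univ, true_and] at hd ⊢
    exact hP.trans _ _ _ hxy hd
  -- `g` sorts by deadline, then by `T₀`.
  let g : Fin m → ℕ := fun x => e x * (m + 1) + position T₀ x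
  have hlt : ∀ x, position T₀ x < m + 1 := fun x => Nat.lt_succ_of_le (position_le_card T₀ x)
  have hge : ∀ x y, g x ≤ g y → e x ≤ e y := by
    intro x y hxy
    by_contra hlt'
    have h₁ : (e y + 1) * (m + 1) ≤ e x * (m + 1) := Nat.mul_le_mul_right _ (by omega)
    have h₂ := hlt y
    simp only [g] at hxy
    rw [add_one_mul] at h₁
    omega
  have hginj : Function.Injective g := by
    intro x y hxy
    have : e x = e y := le_antisymm (hge x y hxy.le) (hge y x hxy.ge)
    simp only [g, this] at hxy
    exact position_injective hT₀ (by omega)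
  have hgmono : ∀ x y, P x y → g x ≤ g y := fun x y hxy =>
    Nat.add_le_add (Nat.mul_le_mul_right _ (hemono x y hxy)) (position_mono hT₀ (hPT₀ _ _ hxy))
  obtain ⟨hU, hL⟩ := h
  obtain ⟨F, hFA, hF, hseg⟩ := exists_initial_segment (univ \ below P c) hginj (n := q - 1) (by
    rw [card_sdiff_of_subset (subset_univ _), card_univ, Fintype.card_fin]
    omega)
  -- `f` sorts the first `q - 1` candidates before the others, and each part by `g`.
  let M : ℕ := univ.sup g + 1
  have hM : ∀ x, g x < M := fun x => Nat.lt_succ_of_le (le_sup (mem_univ x))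
  let f : Fin m → ℕ := fun x => if x ∈ F then g x else M + g x
  have hfinj : Function.Injective f := by
    intro x y hxy
    have hx := hM x
    have hy := hM y
    apply hginj
    simp only [f] at hxy
    split_ifs at hxy <;> omega
  have hFdown : ∀ x y, P x y → y ∈ F → x ∈ F := by
    intro x y hxy hy
    by_contra hx
    have hyA := hFA hy
    simp only [mem_sdiff, mem_univ, true_and, mem_below] at hyA
    have hxA : x ∈ univ \ below P c := by
      simp only [mem_sdiff, mem_univ, true_and, mem_below]
      exact fun hcx => hyA (hP.trans _ _ _ hcx hxy)
    exact absurd (hseg y hy x hxA hx) (not_lt.2 (hgmono x y hxy))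
  have hcF : c ∉ F := fun hc => by
    have := hFA hc
    simp only [mem_sdiff, mem_univ, true_and, mem_below] at this
    exact this (hP.refl c)
  have hpos : ∀ x, position (fun a b => f a ≤ f b) x = (univ.filter fun y => f y ≤ f x).card :=
    fun x => by unfold position; congr!
  refine ⟨fun a b => f a ≤ f b, ?_, ?_, ?_, ?_⟩
  · exact
      { refl := fun a => le_rfl
        trans := fun a b c h h' => le_trans h h'
        antisymm := fun a b h h' => hfinj (le_antisymm h h')
        total := fun a b => le_total _ _ }
  · intro x y hxy
    have h₁ := hgmono x y hxy
    have h₂ := hFdown x y hxy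
    have h₃ := hM x
    simp only [f]
    split_ifs with hx hy hy
    · exact h₁
    · omega
    · exact absurd (h₂ hy) hx
    · omega
  · rw [hpos]
    have : insert c F ⊆ univ.filter fun y => f y ≤ f c := by
      intro y hy
      simp only [mem_filter, mem_univ, true_and]
      rcases mem_insert.1 hy with rfl | hy
      · exact le_rfl
      · have := hM y
        simp only [f, hy, hcF, if_true, if_false]
        omega
    have := card_le_card this
    rw [card_insert_of_notMem hcF, hF] at this
    omega
  · intro d
    rw [hpos]
    obtain ⟨h₁, h₂⟩ := hL (p d) (Nat.lt_succ_of_le (hp d))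
    have hd : D d ∈ forced P D p (p d) := mem_forced.2 ⟨d, le_rfl, hP.refl _⟩
    have hgL : ∀ y, g y ≤ g (D d) → y ∈ forced P D p (p d) := fun y hy =>
      (he y _ (hp d)).1 ((hge _ _ hy).trans ((he _ _ (hp d)).2 hd))
    -- If `D d` is among the first `q - 1`, everything up to it has a deadline of at most `p d`.
    -- If it is not, the candidates up to it lie in `F` or have such a deadline. In the case that
    -- some member of `F` has a later deadline, the candidates outside `F` with a deadline of at
    -- most `p d` are all in `below P c`, and the bound for the interval `[q, p d]` applies.
    by_cases hdF : D d ∈ F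
    · refine (card_le_card fun y hy => ?_).trans h₁
      simp only [mem_filter, mem_univ, true_and, f, if_pos hdF] at hy
      have := hM (D d)
      refine hgL y ?_
      split_ifs at hy <;> omega
    · have hsub : (univ.filter fun y => f y ≤ f (D d)) ⊆ F ∪ forced P D p (p d) := by
        intro y hy
        simp only [mem_filter, mem_univ, true_and, f, if_neg hdF] at hy
        by_cases hyF : y ∈ F
        · exact mem_union_left _ hyF
        · rw [if_neg hyF] at hy
          exact mem_union_right _ (hgL y (by omega))
      by_cases hFL : F ⊆ forced P D p (p d)
      · rw [union_eq_right.2 hFL] at hsub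
        exact (card_le_card hsub).trans h₁
      · obtain ⟨x, hx, hxL⟩ := not_subset.1 hFL
        have hsub' : ∀ y ∈ forced P D p (p d), y ∉ F → y ∈ below P c := by
          intro y hy hyF
          by_contra hyU
          have := hseg x hx y (mem_sdiff.2 ⟨mem_univ _, hyU⟩) hyF
          exact hxL ((he x _ (hp d)).1 ((hge x y this.le).trans ((he y _ (hp d)).2 hy)))
        have hsub'' : F ∪ forced P D p (p d) ⊆ F ∪ (forced P D p (p d) ∩ below P c) := by
          intro y hy
          by_cases hyF : y ∈ F
          · exact mem_union_left _ hyF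
          · have hyL := (mem_union.1 hy).resolve_left hyF
            exact mem_union_right _ (mem_inter.2 ⟨hyL, hsub' y hyL hyF⟩)
        have h₃ := (card_le_card (hsub.trans hsub'')).trans (card_union_le _ _)
        have h₄ : 0 < (forced P D p (p d) ∩ below P c).card :=
          card_pos.2 ⟨D d, mem_inter.2 ⟨hd, hsub' _ hd hdF⟩⟩
        omega

end Schedule

/-! ### The maximal rank in terms of bounds on positions -/

/-- With `x` and `y` the scores of `c` and `d`, the candidate `d` precedes `c` in the result. -/
def Beats {m : ℕ} (tie : Fin m → Fin m → Prop) (c d : Fin m) (x y : ℕ) : Prop :=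
  x < y ∨ (x = y ∧ tie d c)

/-- The maximal rank of `c` exceeds `k` if and only if some `k` other candidates can beat `c` at
once. As scores do not increase along the positions, it is enough that each voter has a linear
extension with `c` at position `q i` or below and `D d` at position `p i d` or above, for numbers
whose scores make every `D d` beat `c`. -/
theorem lt_maxRank_iff {m n : ℕ} (r : PositionalScoringRule) (P : Fin n → Fin m → Fin m → Prop)
    (hP : ∀ i, IsPartialOrder (Fin m) (P i)) (tie : Fin m → Fin m → Prop)
    (htie : IsLinearOrder (Fin m) tie) (c : Fin m) (k : ℕ) :
    k < maxRank r P tie c ↔ ∃ D : Fin k → Fin m, Function.Injective D ∧ (∀ d, D d ≠ c) ∧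
      ∃ (q : Fin n → ℕ) (p : Fin n → Fin k → ℕ),
        (∀ i, (1 ≤ q i ∧ q i ≤ m) ∧ (∀ d, 1 ≤ p i d ∧ p i d ≤ m) ∧
          Feasible (P i) c D (q i) (p i)) ∧
        ∀ d, Beats tie c (D d) (∑ i, r.score m (q i)) (∑ i, r.score m (p i d)) := by
  classical
  constructor
  · intro h
    obtain ⟨T, hT, hrank⟩ := (isGreatest_maxRank r P hP tie c).1
    rw [← hrank] at h
    have hs : k ≤ ((univ.filter fun d => resultOrder r T tie d c).erase c).card := by
      rw [card_erase_of_mem]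
      · have : rank r T tie c = (univ.filter fun d => resultOrder r T tie d c).card := by
          unfold rank position; congr!
        omega
      · simp only [mem_filter, mem_univ, true_and]
        exact Or.inr ⟨rfl, htie.refl c⟩
    obtain ⟨s, hs, hcard⟩ := exists_subset_card_eq hs
    let D : Fin k → Fin m := fun d => s.orderEmbOfFin hcard d
    have hD : ∀ d, D d ≠ c ∧ resultOrder r T tie (D d) c := fun d => by
      simpa using hs (s.orderEmbOfFin_mem hcard d)
    refine ⟨D, (s.orderEmbOfFin hcard).injective, fun d => (hD d).1,
      fun i => position (T i) c, fun i d => position (T i) (D d), fun i => ?_,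
      fun d => (hD d).2.imp id (And.imp_left Eq.symm)⟩
    have hTi := (hT i).1
    exact ⟨⟨one_le_position hTi c, position_le_card _ c⟩,
      fun d => ⟨one_le_position hTi _, position_le_card _ _⟩,
      feasible_of_linearOrder (hP i) hTi (hT i).2 le_rfl fun d => le_rfl⟩
  · rintro ⟨D, hD, hDc, q, p, hqp, hbeat⟩
    have hex := fun i =>
      (hqp i).2.2.exists_linearOrder (hP i) (hqp i).1.1 fun d => ((hqp i).2.1 d).2
    choose T hT hPT hqT hpT using hex
    refine lt_of_lt_of_le ?_ ((isGreatest_maxRank r P hP tie c).2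
      ⟨T, fun i => ⟨hT i, hPT i⟩, rfl⟩)
    have hc : totalScore r T c ≤ ∑ i, r.score m (q i) :=
      sum_le_sum fun i _ => r.antitone m _ _ (hqp i).1.1 (hqT i) (position_le_card _ _)
    have hd : ∀ d, ∑ i, r.score m (p i d) ≤ totalScore r T (D d) := fun d =>
      sum_le_sum fun i _ => r.antitone m _ _ (one_le_position (hT i) _) (hpT i d)
        ((hqp i).2.1 d).2
    have hsub : insert c (univ.image D) ⊆ univ.filter fun d => resultOrder r T tie d c := by
      intro x hx
      simp only [mem_filter, mem_univ, true_and]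
      rcases mem_insert.1 hx with rfl | hx
      · exact Or.inr ⟨rfl, htie.refl x⟩
      · obtain ⟨d, -, rfl⟩ := mem_image.1 hx
        have h₁ := hd d
        rcases hbeat d with h | ⟨h, h'⟩
        · exact Or.inl (by omega)
        · rcases (show totalScore r T c ≤ totalScore r T (D d) by omega).lt_or_eq with h | h
          · exact Or.inl h
          · exact Or.inr ⟨h.symm, h'⟩
    have hcard := card_le_card hsub
    rw [card_insert_of_notMem (by simpa using fun d => hDc d), card_image_of_injective _ hD,
      card_univ, Fintype.card_fin] at hcard
    have : rank r T tie c = (univ.filter fun d => resultOrder r T tie d c).card := by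
      unfold rank position; congr!
    omega

end RankVoting

namespace StackProgram

open Function Turing
variable {O : Oracle}
open Data (Ix enc)
variable {α β γ : Type} [Data α] [Data β] [Data γ]

/-! ### Conversion from binary to unary -/

theorem poly_replicate_append {n : α → ℕ} {l : α → List Bool} (hn : Poly O n) (hl : Poly O l) :
    Poly O fun a => List.replicate (n a) true ++ l a := by
  have key : ∀ (l : List Bool) i,
      (Nat.rec l (fun _ l => true :: l) i : List Bool) = List.replicate i true ++ l := by
    intro l i
    induction i with
    | zero => rfl
    | succ i ih => simp only [ih, List.replicate_succ, List.cons_append]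
  have h := Poly.natRec (O := O) (init := l) (step := fun _ _ l => true :: l) hn hl (by fun_prop)
    (hn.nat_bdd.add hl.length_polyBdd) (fun a i hi => by simp [key]; exact hi)
  simpa only [key] using h

/-- The number with the given binary digits, the least significant one first. -/
def bitsValue : List Bool → ℕ
  | [] => 0
  | b :: l => 2 * bitsValue l + b.toNat

theorem bitsValue_encodePosNum (n : PosNum) : bitsValue (Computability.encodePosNum n) = n := by
  induction n with
  | one => rfl
  | bit0 n ih => simp [Computability.encodePosNum, bitsValue, ih, PosNum.cast_bit0]; ring
  | bit1 n ih => simp [Computability.encodePosNum, bitsValue, ih, PosNum.cast_bit1]; ring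

theorem bitsValue_encodeNat (n : ℕ) : bitsValue (Computability.encodeNat n) = n := by
  conv_rhs => rw [← Num.to_of_nat n]
  unfold Computability.encodeNat
  cases (n : Num) with
  | zero => rfl
  | pos p => exact bitsValue_encodePosNum p

theorem length_encodeNat_le (n : ℕ) : (Computability.encodeNat n).length ≤ n := by
  have key : ∀ p : PosNum, (Computability.encodePosNum p).length ≤ (p : ℕ) := by
    intro p
    induction p with
    | one => simp [Computability.encodePosNum]
    | bit0 n ih =>
      have : 0 < (n : ℕ) := PosNum.cast_pos n
      simp only [Computability.encodePosNum, List.length_cons, PosNum.cast_bit0]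
      omega
    | bit1 n ih =>
      simp only [Computability.encodePosNum, List.length_cons, PosNum.cast_bit1]
      omega
  conv_rhs => rw [← Num.to_of_nat n]
  unfold Computability.encodeNat
  cases (n : Num) with
  | zero => rfl
  | pos p => exact key p

/-- The number whose binary digits are the first `i` bits of `l`, the most significant one first. -/
def horner (l : List Bool) (i : ℕ) : ℕ :=
  Nat.rec 0 (fun i x => x + x + bif bitAt l i then 1 else 0) i

theorem horner_append (l l' : List Bool) {i : ℕ} (hi : i ≤ l.length) :
    horner (l ++ l') i = horner l i := by
  induction i with
  | zero => rfl
  | succ i ih =>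
    change horner (l ++ l') i + horner (l ++ l') i + (bif bitAt (l ++ l') i then 1 else 0) =
      horner l i + horner l i + bif bitAt l i then 1 else 0
    rw [ih (by omega), bitAt, bitAt, List.getD_append _ _ _ _ (by omega)]

theorem horner_reverse (l : List Bool) : horner l.reverse l.length = bitsValue l := by
  induction l with
  | nil => rfl
  | cons b l ih =>
    rw [List.reverse_cons, List.length_cons]
    change horner (l.reverse ++ [b]) l.length + horner (l.reverse ++ [b]) l.length +
      (bif bitAt (l.reverse ++ [b]) l.length then 1 else 0) = _
    rw [horner_append _ _ (by simp), ih, bitAt, List.getD_append_right _ _ _ _ (by simp)]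
    cases b <;> simp [bitsValue, two_mul]

/-- A binary number can be converted to unary in polynomial time if its value is polynomially
bounded. -/
theorem poly_bitsValue {l : α → List Bool} (hl : Poly O fun a => (l a).reverse)
    (hb : PolyBdd fun a => bitsValue (l a)) : Poly O fun a => bitsValue (l a) := by
  have hmono : ∀ l, Monotone (horner l) := fun l => monotone_nat_of_le_succ fun i => by
    change horner l i ≤ horner l i + horner l i + _
    omega
  have h := Poly.natRec (O := O) (n := fun a => (l a).reverse.length) (init := fun _ => 0)
    (step := fun a i x => x + x + bif bitAt (l a).reverse i then 1 else 0) hl.length (by fun_prop)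
    (by
      have : Poly O fun x : α × ℕ × ℕ => (l x.1).reverse :=
        hl.comp (f := fun x : α × ℕ × ℕ => x.1) (by fun_prop)
      fun_prop) hb (fun a i hi => by
        rw [size_nat, ← horner_reverse]
        exact hmono _ (by simpa using hi))
  refine cast (congrArg _ (funext fun a => ?_)) h
  rw [← horner_reverse]
  simp only [List.length_reverse]
  rfl

end StackProgram

namespace RankVoting

open Function Turing
open StackProgram

/-! ### Computing the scores -/

instance : Data ScoreArg where
  Ix := Data.Ix (ℕ × ℕ)
  enc x := Data.enc x.1

/-- The scores with the arguments moved into the range `1 ≤ j ≤ m`, on which a scoring rule can be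
computed: `m` is replaced by `max m 1`, and `j` by the nearest position. -/
def PositionalScoringRule.clamped (r : PositionalScoringRule) (m j : ℕ) : ℕ :=
  r.score (m - 1 + 1) (j - 1 - (j - 1 - (m - 1)) + 1)

theorem PositionalScoringRule.clamped_eq (r : PositionalScoringRule) {m j : ℕ} (hj : 1 ≤ j)
    (hjm : j ≤ m) : r.clamped m j = r.score m j := by
  unfold clamped
  congr 1 <;> omega

variable {r : PositionalScoringRule}

/-- Relative to the machine that computes the scores in binary, the scores are computable in
unary. -/
theorem exists_poly_clamped (hcomp : r.PolyTimeComputable) (hpoly : r.HasPolynomialScores) :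
    ∃ (tm : FinTM2) (inp : tm.Γ tm.k₀ ≃ Bool) (outp : tm.Γ tm.k₁ ≃ Bool),
      Poly (machineOracle inp outp) fun x : ℕ × ℕ => r.clamped x.1 x.2 := by
  obtain ⟨h⟩ := hcomp
  obtain ⟨B, hB⟩ := hpoly
  refine ⟨h.tm, h.inputAlphabet, h.outputAlphabet, ?_⟩
  set O := machineOracle h.inputAlphabet h.outputAlphabet
  have h₁ : Poly O fun x : ScoreArg => x.1 := Poly.of_reindex (fun i => i) fun _ _ => rfl
  have hs : PolyBdd fun x : ScoreArg => r.score x.1.1 x.1.2 :=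
    (h₁.fst'.nat_bdd.eval B).mono fun x => hB _ _ x.2.1 x.2.2
  have hw : Poly O fun x : ScoreArg =>
      List.replicate x.1.2 true ++ false :: List.replicate x.1.1 true :=
    poly_replicate_append h₁.snd' (h₁.fst'.replicate.cons false)
  have hrev : ∀ x : ScoreArg, (List.replicate x.1.2 true ++ false ::
      List.replicate x.1.1 true).reverse = x.encode := fun x => by simp [ScoreArg.encode]
  have hcall : Poly O fun x : ScoreArg =>
      (Computability.encodeNat (r.score x.1.1 x.1.2)).reverse := by
    refine Poly.call hw (t := fun x => h.time.eval x.encode.length) ?_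
      (hs.mono fun x => length_encodeNat_le _) fun x => ?_
    · refine PolyBdd.eval (hw.length_polyBdd.mono fun x => ?_) h.time
      rw [← hrev, List.length_reverse]
    · rw [hrev]
      obtain ⟨⟨t, ht⟩, hle⟩ := h.outputsFun x
      exact ⟨t, hle, ht⟩
  have hscore : Poly O fun x : ScoreArg => r.score x.1.1 x.1.2 := by
    have := poly_bitsValue hcall (by simpa only [bitsValue_encodeNat] using hs)
    simpa only [bitsValue_encodeNat] using this
  let clamp : ℕ × ℕ → ScoreArg := fun x =>
    ⟨(x.1 - 1 + 1, x.2 - 1 - (x.2 - 1 - (x.1 - 1)) + 1), by dsimp; omega⟩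
  have hclamp : Poly O clamp :=
    (by fun_prop : Poly O fun x : ℕ × ℕ => (x.1 - 1 + 1, x.2 - 1 - (x.2 - 1 - (x.1 - 1)) + 1))
  exact hscore.comp hclamp

/-! ### The decision procedure -/

/-!
The numbers and relations of an input are read off from its encoding, the word `w`, whenever they
are needed. A tuple `v` of `k + 1` positions stands for the position `v 0` of the given candidate
and the positions `v d.succ` of its `k` rivals `D d`; tuples of scores are arranged in the same
way.
-/

section Algorithm

/-- The number of consecutive `true`s in `w` from position `o` on. -/
def lead (w : List Bool) (o : ℕ) : ℕ :=
  countBelow w.length fun i => allBelow (i + 1) fun j => bitAt w (o + j)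

/-- The number of candidates. -/
def numCandidates (w : List Bool) : ℕ := lead w 0

/-- The number of voters. -/
def numVoters (w : List Bool) : ℕ := lead w (numCandidates w + 1)

/-- The candidate whose rank is asked for. -/
def givenCandidate (w : List Bool) : ℕ := lead w (numCandidates w + 1 + (numVoters w + 1))

/-- The entry at `(a, b)` of matrix number `i`. The matrix of the tiebreaker has number `0`, and
that of voter `i` has number `i + 1`. -/
def matrixBit (w : List Bool) (i a b : ℕ) : Bool :=
  bitAt w (numCandidates w + 1 + (numVoters w + 1) + (givenCandidate w + 1) +
    (i * (numCandidates w * numCandidates w) + (a * numCandidates w + b)))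

/-- Whether the candidate `x` is in the set `forced` of voter `i`. -/
def forcedBit {k : ℕ} (w : List Bool) (i : ℕ) (D : Fin k → ℕ) (v : Fin (k + 1) → ℕ)
    (t x : ℕ) : Bool :=
  (List.finRange k).any fun d => Nat.ble (v d.succ) t && matrixBit w (i + 1) x (D d)

/-- Whether the condition `Feasible` holds for voter `i`. -/
def feasibleBit {k : ℕ} (w : List Bool) (i : ℕ) (D : Fin k → ℕ) (v : Fin (k + 1) → ℕ) : Bool :=
  Nat.ble (countBelow (numCandidates w) (fun x => matrixBit w (i + 1) (givenCandidate w) x) + v 0)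
    (numCandidates w + 1) &&
  allBelow (numCandidates w + 1) fun t =>
    Nat.ble (countBelow (numCandidates w) fun x => forcedBit w i D v t x) t &&
    (Nat.beq (countBelow (numCandidates w) fun x =>
        forcedBit w i D v t x && matrixBit w (i + 1) (givenCandidate w) x) 0 ||
      Nat.ble ((countBelow (numCandidates w) fun x =>
        forcedBit w i D v t x && matrixBit w (i + 1) (givenCandidate w) x) + v 0) (t + 1))

/-- The number with digits `s` in base `B`, the least significant one first. -/
def ofDigits {k : ℕ} (B : ℕ) (s : Fin k → ℕ) : ℕ := ∑ j : Fin k, s j * B ^ (j : ℕ)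

/-- The table that tells which numbers below `N` are of the form `W (v 0) + ⋯ + W (v (n - 1))` with
tuples `v i` of numbers below `M` that satisfy `a i`. It is computed by dynamic programming, one
summand after the other. The entry for `x` is at position `N - 1 - x`, as tables are built like
stacks. -/
def sumTable {k : ℕ} (a : ℕ → (Fin k → ℕ) → Bool) (W : (Fin k → ℕ) → ℕ) (M N n : ℕ) :
    List Bool :=
  iterTable N (fun y => Nat.beq y 0) (fun i l y => anyTuple k M fun v =>
    a i v && Nat.ble (W v) y && bitAt l (N - 1 - (y - W v))) n

/-- A strict upper bound for the total scores. -/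
def scoreBase (sc : ℕ → ℕ → ℕ) (w : List Bool) : ℕ :=
  numVoters w * sc (numCandidates w) 1 + 1

/-- Whether voter `i` can satisfy the bounds `v` on the positions. -/
def voterBit {k : ℕ} (w : List Bool) (D : Fin k → ℕ) (i : ℕ) (v : Fin (k + 1) → ℕ) : Bool :=
  ((List.finRange (k + 1)).all fun j => Nat.ble 1 (v j)) && feasibleBit w i D v

/-- The scores for the positions `v`, encoded as the digits of a number. As no total score reaches
the base, adding up such numbers does not produce carries. -/
def scoreWeight {k : ℕ} (sc : ℕ → ℕ → ℕ) (w : List Bool) (v : Fin k → ℕ) : ℕ :=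
  ofDigits (scoreBase sc w) fun j => sc (numCandidates w) (v j)

/-- Whether the rivals `D` are distinct, and distinct from the given candidate. -/
def distinctBit {k : ℕ} (w : List Bool) (D : Fin k → ℕ) : Bool :=
  (List.finRange k).all fun d => !Nat.beq (D d) (givenCandidate w) &&
    (List.finRange k).all fun d' => decide (d = d') || !Nat.beq (D d) (D d')

/-- Whether all rivals beat the given candidate if the total scores are `s`. -/
def beatsBit {k : ℕ} (w : List Bool) (D : Fin k → ℕ) (s : Fin (k + 1) → ℕ) : Bool :=
  (List.finRange k).all fun d => Nat.ble (s 0 + 1) (s d.succ) ||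
    Nat.beq (s 0) (s d.succ) && matrixBit w 0 (D d) (givenCandidate w)

/-- Whether the table `T` of reachable total scores contains some for which all rivals beat the
given candidate. -/
def reachableBit {k : ℕ} (sc : ℕ → ℕ → ℕ) (w : List Bool) (D : Fin k → ℕ)
    (T : List Bool) : Bool :=
  anyTuple (k + 1) (scoreBase sc w) fun s =>
    bitAt T (scoreBase sc w ^ (k + 1) - 1 - ofDigits (scoreBase sc w) s) && beatsBit w D s

/-- Whether some `k` rivals can beat the given candidate at once. -/
def answer (k : ℕ) (sc : ℕ → ℕ → ℕ) (w : List Bool) : Bool :=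
  anyTuple k (numCandidates w) fun D => distinctBit w D &&
    reachableBit sc w D (sumTable (voterBit w D) (scoreWeight sc w) (numCandidates w + 1)
      (scoreBase sc w ^ (k + 1)) (numVoters w))

variable {O : Oracle} {α : Type} [Data α] {w : α → List Bool} {k : ℕ}

@[fun_prop]
theorem poly_lead {o : α → ℕ} (hw : Poly O w) (ho : Poly O o) :
    Poly O fun a => lead (w a) (o a) := by
  unfold lead
  fun_prop

@[fun_prop]
theorem poly_numCandidates (hw : Poly O w) : Poly O fun a => numCandidates (w a) := by
  unfold numCandidates
  fun_prop

@[fun_prop]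
theorem poly_numVoters (hw : Poly O w) : Poly O fun a => numVoters (w a) := by
  unfold numVoters
  fun_prop

@[fun_prop]
theorem poly_givenCandidate (hw : Poly O w) : Poly O fun a => givenCandidate (w a) := by
  unfold givenCandidate
  fun_prop

@[fun_prop]
theorem poly_matrixBit {i x y : α → ℕ} (hw : Poly O w) (hi : Poly O i) (hx : Poly O x)
    (hy : Poly O y) : Poly O fun a => matrixBit (w a) (i a) (x a) (y a) := by
  unfold matrixBit
  fun_prop

@[fun_prop]
theorem poly_forcedBit {i t x : α → ℕ} {D : α → Fin k → ℕ} {v : α → Fin (k + 1) → ℕ}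
    (hw : Poly O w) (hi : Poly O i) (hD : Poly O D) (hv : Poly O v) (ht : Poly O t)
    (hx : Poly O x) : Poly O fun a => forcedBit (w a) (i a) (D a) (v a) (t a) (x a) := by
  unfold forcedBit
  fun_prop

@[fun_prop]
theorem poly_feasibleBit {i : α → ℕ} {D : α → Fin k → ℕ} {v : α → Fin (k + 1) → ℕ}
    (hw : Poly O w) (hi : Poly O i) (hD : Poly O D) (hv : Poly O v) :
    Poly O fun a => feasibleBit (w a) (i a) (D a) (v a) := by
  unfold feasibleBit
  fun_prop

@[fun_prop]
theorem poly_voterBit {i : α → ℕ} {D : α → Fin k → ℕ} {v : α → Fin (k + 1) → ℕ}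
    (hw : Poly O w) (hi : Poly O i) (hD : Poly O D) (hv : Poly O v) :
    Poly O fun a => voterBit (w a) (D a) (i a) (v a) := by
  unfold voterBit
  fun_prop

@[fun_prop]
theorem poly_ofDigits {B : α → ℕ} {s : α → Fin k → ℕ} (hB : Poly O B) (hs : Poly O s) :
    Poly O fun a => ofDigits (B a) (s a) := by
  unfold ofDigits
  fun_prop

@[fun_prop]
theorem poly_distinctBit {D : α → Fin k → ℕ} (hw : Poly O w) (hD : Poly O D) :
    Poly O fun a => distinctBit (w a) (D a) := by
  unfold distinctBit
  fun_prop

@[fun_prop]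
theorem poly_beatsBit {D : α → Fin k → ℕ} {s : α → Fin (k + 1) → ℕ} (hw : Poly O w)
    (hD : Poly O D) (hs : Poly O s) : Poly O fun a => beatsBit (w a) (D a) (s a) := by
  unfold beatsBit
  fun_prop

variable {sc : ℕ → ℕ → ℕ}

theorem poly_scoreBase (hsc : Poly O fun x : ℕ × ℕ => sc x.1 x.2) (hw : Poly O w) :
    Poly O fun a => scoreBase sc (w a) := by
  have : Poly O fun a => sc (numCandidates (w a)) 1 :=
    hsc.comp (f := fun a => (numCandidates (w a), 1)) (by fun_prop)
  unfold scoreBase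
  fun_prop

theorem poly_scoreWeight (hsc : Poly O fun x : ℕ × ℕ => sc x.1 x.2) {v : α → Fin k → ℕ}
    (hw : Poly O w) (hv : Poly O v) : Poly O fun a => scoreWeight sc (w a) (v a) := by
  have h : ∀ j, Poly O fun a => sc (numCandidates (w a)) (v a j) := fun j =>
    hsc.comp (f := fun a => (numCandidates (w a), v a j)) (by fun_prop)
  have := poly_scoreBase hsc hw
  unfold scoreWeight ofDigits
  fun_prop

theorem poly_answer (hsc : Poly O fun x : ℕ × ℕ => sc x.1 x.2) (k : ℕ) :
    Poly O fun w => answer k sc w := by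
  have hB : Poly O fun w => scoreBase sc w := poly_scoreBase hsc (by fun_prop)
  have hW : Poly O fun x : List Bool × (Fin (k + 1) → ℕ) => scoreWeight sc x.1 x.2 :=
    poly_scoreWeight hsc (by fun_prop) (by fun_prop)
  unfold answer reachableBit sumTable
  fun_prop

end Algorithm

open Finset

/-! ### Decoding the input -/

section Decoding

theorem lead_append (u v : List Bool) (a : ℕ) :
    lead (u ++ (List.replicate a true ++ false :: v)) u.length = a := by
  have hbit : ∀ j, bitAt (u ++ (List.replicate a true ++ false :: v)) (u.length + j) =
      bitAt (List.replicate a true ++ false :: v) j := fun j => by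
    rw [bitAt, List.getD_append_right _ _ _ _ (by omega), Nat.add_sub_cancel_left, bitAt]
  have hlt : ∀ j < a, bitAt (List.replicate a true ++ false :: v) j = true := fun j hj => by
    rw [bitAt, List.getD_append _ _ _ _ (by simpa using hj)]
    simp [List.getD_eq_getElem?_getD, hj]
  have heq : bitAt (List.replicate a true ++ false :: v) a = false := by
    rw [bitAt, List.getD_append_right _ _ _ _ (by simp)]
    simp
  unfold lead
  rw [countBelow_eq]
  refine (congrArg card ?_).trans (card_range a)
  ext i
  simp only [mem_filter, mem_range, allBelow_iff, hbit, List.length_append, List.length_cons,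
    List.length_replicate]
  constructor
  · rintro ⟨-, h⟩
    by_contra hi
    rw [h a (by omega)] at heq
    exact Bool.noConfusion heq
  · exact fun hi => ⟨by omega, fun j hj => hlt j (by omega)⟩

/-- Position `i * b + j` of a concatenation of blocks of length `b` is position `j` of block `i`. -/
theorem bitAt_flatMap {ι : Type} {f : ι → List Bool} {b : ℕ} (hf : ∀ x, (f x).length = b)
    (l : List ι) {i : ℕ} (hi : i < l.length) {j : ℕ} (hj : j < b) :
    bitAt (l.flatMap f) (i * b + j) = bitAt (f l[i]) j := by
  induction l generalizing i with
  | nil => simp at hi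
  | cons x l ih =>
    rw [List.flatMap_cons, bitAt]
    cases i with
    | zero =>
      rw [List.getD_append _ _ _ _ (by rw [hf]; omega), zero_mul, zero_add]
      rfl
    | succ i =>
      rw [List.getD_append_right _ _ _ _ (by rw [hf, add_one_mul]; omega), hf,
        show (i + 1) * b + j - b = i * b + j by rw [add_one_mul]; omega]
      exact ih (by simpa using hi)

theorem length_relationBits {m : ℕ} (R : Fin m → Fin m → Prop) :
    (relationBits R).length = m * m := by
  simp [relationBits, List.length_flatMap]

theorem bitAt_relationBits {m : ℕ} (R : Fin m → Fin m → Prop) (a b : Fin m) :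
    bitAt (relationBits R) (a * m + b) = true ↔ R a b := by
  classical
  unfold relationBits
  rw [bitAt_flatMap (b := m) (by simp) _ (by simp) b.2]
  simp [bitAt]

theorem countBelow_eq_card {m : ℕ} {f : ℕ → Bool} {s : Finset (Fin m)}
    (h : ∀ x : Fin m, f x = true ↔ x ∈ s) : countBelow m f = s.card := by
  rw [countBelow_eq, ← card_map Fin.valEmbedding]
  congr 1
  ext x
  simp only [mem_filter, mem_range, mem_map, Fin.valEmbedding_apply]
  constructor
  · rintro ⟨hx, hf⟩
    exact ⟨⟨x, hx⟩, (h ⟨x, hx⟩).1 hf, rfl⟩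
  · rintro ⟨y, hy, rfl⟩
    exact ⟨y.2, (h y).2 hy⟩

variable (I : Instance)

theorem numCandidates_encode : numCandidates I.encode = I.m :=
  lead_append [] _ _

theorem numVoters_encode : numVoters I.encode = I.n := by
  have := lead_append (List.replicate I.m true ++ [false])
    (List.replicate (I.c : ℕ) true ++ false ::
      (relationBits I.tie ++ (List.finRange I.n).flatMap fun i => relationBits (I.profile i))) I.n
  rw [numVoters, numCandidates_encode]
  simpa [Instance.encode] using this

theorem givenCandidate_encode : givenCandidate I.encode = I.c := by
  have := lead_append (List.replicate I.m true ++ false :: (List.replicate I.n true ++ [false]))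
    (relationBits I.tie ++ (List.finRange I.n).flatMap fun i => relationBits (I.profile i)) I.c
  rw [givenCandidate, numVoters_encode, numCandidates_encode]
  simpa [Instance.encode, add_assoc, add_left_comm 1] using this

theorem matrixBit_encode (i : ℕ) (a b : Fin I.m) : matrixBit I.encode i a b =
    bitAt (relationBits I.tie ++ (List.finRange I.n).flatMap fun i => relationBits (I.profile i))
      (i * (I.m * I.m) + (a * I.m + b)) := by
  unfold matrixBit
  rw [givenCandidate_encode, numVoters_encode, numCandidates_encode]
  have hlen : I.m + 1 + (I.n + 1) + (I.c + 1) = (List.replicate I.m true ++ false ::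
      (List.replicate I.n true ++ false :: (List.replicate (I.c : ℕ) true ++ [false]))).length := by
    simp
    omega
  rw [hlen, bitAt, bitAt, show I.encode = (List.replicate I.m true ++ false ::
      (List.replicate I.n true ++ false :: (List.replicate (I.c : ℕ) true ++ [false]))) ++
      (relationBits I.tie ++ (List.finRange I.n).flatMap fun i => relationBits (I.profile i)) by
    simp [Instance.encode],
    List.getD_append_right _ _ _ _ (by omega), Nat.add_sub_cancel_left]

theorem mul_add_lt_sq {m : ℕ} (a b : Fin m) : (a : ℕ) * m + b < m * m := by
  have := Nat.mul_le_mul_right m (Nat.succ_le_of_lt a.2)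
  rw [Nat.succ_mul] at this
  omega

theorem matrixBit_zero (a b : Fin I.m) : matrixBit I.encode 0 a b = true ↔ I.tie a b := by
  rw [matrixBit_encode, zero_mul, zero_add, bitAt, List.getD_append _ _ _ _
    (by rw [length_relationBits]; exact mul_add_lt_sq a b)]
  exact bitAt_relationBits I.tie a b

theorem matrixBit_succ (i : Fin I.n) (a b : Fin I.m) :
    matrixBit I.encode (i + 1) a b = true ↔ I.profile i a b := by
  rw [matrixBit_encode, bitAt, List.getD_append_right _ _ _ _
    (by rw [length_relationBits, add_one_mul]; omega), length_relationBits,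
    show (i + 1 : ℕ) * (I.m * I.m) + (a * I.m + b) - I.m * I.m = i * (I.m * I.m) + (a * I.m + b) by
      rw [add_one_mul]; omega]
  have := bitAt_flatMap (f := fun i => relationBits (I.profile i)) (b := I.m * I.m)
    (fun i => length_relationBits _) (List.finRange I.n) (i := i) (by simp) (mul_add_lt_sq a b)
  rw [bitAt] at this
  rw [this]
  simpa using bitAt_relationBits (I.profile i) a b

end Decoding

/-! ### Correctness of the decision procedure -/

section Correctness

variable (I : Instance) {k : ℕ}

theorem forcedBit_iff (i : Fin I.n) (D : Fin k → Fin I.m) (v : Fin (k + 1) → ℕ) (t : ℕ)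
    (x : Fin I.m) : forcedBit I.encode i (fun d => D d) v t x = true ↔
      x ∈ forced (I.profile i) D (fun d => v d.succ) t := by
  simp [forcedBit, matrixBit_succ]

theorem feasibleBit_iff (i : Fin I.n) (D : Fin k → Fin I.m) (v : Fin (k + 1) → ℕ) :
    feasibleBit I.encode i (fun d => D d) v = true ↔
      Feasible (I.profile i) I.c D (v 0) fun d => v d.succ := by
  classical
  have h₁ : countBelow I.m (fun x => matrixBit I.encode (i + 1) I.c x) =
      (below (I.profile i) I.c).card :=
    countBelow_eq_card fun x => by rw [matrixBit_succ, mem_below]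
  have h₂ : ∀ t, countBelow I.m (fun x => forcedBit I.encode i (fun d => D d) v t x) =
      (forced (I.profile i) D (fun d => v d.succ) t).card := fun t =>
    countBelow_eq_card fun x => forcedBit_iff I i D v t x
  have h₃ : ∀ t, countBelow I.m (fun x => forcedBit I.encode i (fun d => D d) v t x &&
        matrixBit I.encode (i + 1) I.c x) =
      (forced (I.profile i) D (fun d => v d.succ) t ∩ below (I.profile i) I.c).card := fun t =>
    countBelow_eq_card fun x => by
      rw [Bool.and_eq_true, forcedBit_iff, matrixBit_succ, mem_inter, mem_below]
  unfold feasibleBit Feasible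
  simp only [numCandidates_encode, givenCandidate_encode, h₁, h₂, h₃, Bool.and_eq_true,
    Bool.or_eq_true, allBelow_iff, Nat.ble_eq, Nat.beq_eq]

theorem bitAt_sumTable {a : ℕ → (Fin k → ℕ) → Bool} {W : (Fin k → ℕ) → ℕ} {M N : ℕ} (n : ℕ)
    {x : ℕ} (hx : x < N) : bitAt (sumTable a W M N n) (N - 1 - x) = true ↔
      ∃ V : Fin n → Fin k → ℕ, (∀ i, (∀ j, V i j < M) ∧ a i (V i) = true) ∧
        ∑ i, W (V i) = x := by
  induction n generalizing x with
  | zero =>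
    change bitAt (table N _) _ = true ↔ _
    rw [bitAt_table _ hx]
    rw [Nat.beq_eq]
    simp [eq_comm (a := x)]
  | succ n ih =>
    change bitAt (table N _) _ = true ↔ _
    rw [bitAt_table _ hx]
    simp only [anyTuple_iff, Bool.and_eq_true, Nat.ble_eq]
    constructor
    · rintro ⟨v, hv, ⟨ha, hW⟩, hb⟩
      obtain ⟨V, hV, hsum⟩ := (ih (by omega)).1 hb
      refine ⟨Fin.snoc V v, ?_, ?_⟩
      · simp only [Fin.forall_fin_succ', Fin.snoc_castSucc, Fin.snoc_last]
        exact ⟨hV, hv, ha⟩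
      · simp only [Fin.sum_univ_castSucc, Fin.snoc_castSucc, Fin.snoc_last, hsum]
        omega
    · rintro ⟨V, hV, hsum⟩
      rw [Fin.sum_univ_castSucc] at hsum
      refine ⟨V (Fin.last n), (hV _).1, ⟨(hV (Fin.last n)).2, by omega⟩, (ih (by omega)).2
        ⟨fun i => V i.castSucc, fun i => hV i.castSucc, ?_⟩⟩
      exact Nat.eq_sub_of_add_eq hsum

theorem ofDigits_lt {B : ℕ} {s : Fin k → ℕ} (hs : ∀ j, s j < B) : ofDigits B s < B ^ k := by
  rw [ofDigits, ← finFunctionFinEquiv_apply fun j => (⟨s j, hs j⟩ : Fin B)]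
  exact Fin.is_lt _

theorem ofDigits_inj {B : ℕ} {s s' : Fin k → ℕ} (hs : ∀ j, s j < B) (hs' : ∀ j, s' j < B)
    (h : ofDigits B s = ofDigits B s') : s = s' := by
  rw [ofDigits, ofDigits, ← finFunctionFinEquiv_apply fun j => (⟨s j, hs j⟩ : Fin B),
    ← finFunctionFinEquiv_apply fun j => (⟨s' j, hs' j⟩ : Fin B)] at h
  have := finFunctionFinEquiv.injective (Fin.ext h)
  exact funext fun j => congrArg Fin.val (congrFun this j)

variable {I} (r : PositionalScoringRule)

/-- The search over total scores finds those that arise from bounds on positions that every voter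
can satisfy. -/
theorem reachableBit_iff {D : Fin k → Fin I.m} :
    reachableBit r.clamped I.encode (fun d => (D d : ℕ))
        (sumTable (voterBit I.encode fun d => D d) (scoreWeight r.clamped I.encode)
          (numCandidates I.encode + 1) (scoreBase r.clamped I.encode ^ (k + 1))
          (numVoters I.encode)) = true ↔
      ∃ V : Fin I.n → Fin (k + 1) → ℕ, (∀ i, (∀ j, 1 ≤ V i j ∧ V i j ≤ I.m) ∧
          Feasible (I.profile i) I.c D (V i 0) fun d => V i d.succ) ∧
        ∀ d, Beats I.tie I.c (D d) (∑ i, r.score I.m (V i 0)) (∑ i, r.score I.m (V i d.succ)) := by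
  set B := scoreBase r.clamped I.encode with hB
  have hV : ∀ V : Fin I.n → Fin (k + 1) → ℕ,
      (∀ i, (∀ j, V i j < I.m + 1) ∧ voterBit I.encode (fun d => (D d : ℕ)) i (V i) = true) ↔
        ∀ i, (∀ j, 1 ≤ V i j ∧ V i j ≤ I.m) ∧
          Feasible (I.profile i) I.c D (V i 0) fun d => V i d.succ := fun V =>
    forall_congr' fun i => by
      rw [voterBit, Bool.and_eq_true, feasibleBit_iff, ← and_assoc]
      simp only [List.all_eq_true, List.mem_finRange, true_imp_iff, Nat.ble_eq, ← forall_and,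
        Nat.lt_succ_iff, and_comm]
  have hbeats : ∀ s : Fin (k + 1) → ℕ, beatsBit I.encode (fun d => (D d : ℕ)) s = true ↔
      ∀ d, Beats I.tie I.c (D d) (s 0) (s d.succ) := fun s => by
    simp only [beatsBit, givenCandidate_encode, List.all_eq_true, List.mem_finRange, true_imp_iff,
      Bool.or_eq_true, Bool.and_eq_true, Nat.ble_eq, Nat.beq_eq, matrixBit_zero, Beats,
      Nat.succ_le_iff]
  have hdigit : ∀ V : Fin I.n → Fin (k + 1) → ℕ, (∀ i j, 1 ≤ V i j ∧ V i j ≤ I.m) → ∀ j,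
      ∑ i, r.score I.m (V i j) < B := by
    intro V hV j
    rw [hB, scoreBase, numVoters_encode, numCandidates_encode, Nat.lt_succ_iff]
    refine (sum_le_card_nsmul univ _ (r.clamped I.m 1) fun i _ => ?_).trans (by simp)
    rw [r.clamped_eq le_rfl ((hV i j).1.trans (hV i j).2)]
    exact r.antitone _ _ _ le_rfl (hV i j).1 (hV i j).2
  -- The weights add up digit by digit.
  have hsum : ∀ V : Fin I.n → Fin (k + 1) → ℕ, (∀ i j, 1 ≤ V i j ∧ V i j ≤ I.m) →
      ∑ i, scoreWeight r.clamped I.encode (V i) =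
        ofDigits B fun j => ∑ i, r.score I.m (V i j) := by
    intro V hV
    simp only [scoreWeight, ofDigits, ← hB, numCandidates_encode, sum_mul]
    rw [sum_comm]
    refine sum_congr rfl fun j _ => sum_congr rfl fun i _ => ?_
    rw [r.clamped_eq (hV i j).1 (hV i j).2]
  unfold reachableBit
  simp only [anyTuple_iff, Bool.and_eq_true, hbeats, numCandidates_encode, numVoters_encode, ← hB]
  constructor
  · rintro ⟨s, hs, hbit, hb⟩
    obtain ⟨V, h, he⟩ := (bitAt_sumTable _ (ofDigits_lt hs)).1 hbit
    rw [hV] at h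
    have hr : ∀ i j, 1 ≤ V i j ∧ V i j ≤ I.m := fun i => (h i).1
    rw [hsum V hr] at he
    obtain rfl := ofDigits_inj (hdigit V hr) hs he
    exact ⟨V, h, hb⟩
  · rintro ⟨V, h, hb⟩
    have hr : ∀ i j, 1 ≤ V i j ∧ V i j ≤ I.m := fun i => (h i).1
    refine ⟨_, hdigit V hr, (bitAt_sumTable _ (ofDigits_lt (hdigit V hr))).2 ?_, hb⟩
    exact ⟨V, (hV V).2 h, hsum V hr⟩

theorem distinctBit_iff {D : Fin k → Fin I.m} :
    distinctBit I.encode (fun d => (D d : ℕ)) = true ↔ Injective D ∧ ∀ d, D d ≠ I.c := by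
  have hne : ∀ x y : Fin I.m, Nat.beq x y = false ↔ x ≠ y := fun x y => by
    rw [← Bool.not_eq_true, Nat.beq_eq, Fin.val_inj]
  simp only [distinctBit, givenCandidate_encode, List.all_eq_true, List.mem_finRange, true_imp_iff,
    Bool.and_eq_true, Bool.or_eq_true, Bool.not_eq_true', decide_eq_true_eq, hne, forall_and]
  refine and_comm.trans (and_congr_left' (forall₂_congr fun d d' => ?_))
  rw [or_iff_not_imp_right, not_not]

theorem answer_encode (k : ℕ) (I : Instance) :
    answer k r.clamped I.encode = I.maxRankExceeds r k := by
  rw [Bool.eq_iff_iff, Instance.maxRankExceeds, decide_eq_true_eq,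
    lt_maxRank_iff r _ I.profile_isPartialOrder _ I.tie_isLinearOrder]
  unfold answer
  rw [anyTuple_iff]
  constructor
  · rintro ⟨D, hD, h⟩
    rw [numCandidates_encode] at hD
    lift D to Fin k → Fin I.m using hD
    rw [Bool.and_eq_true, distinctBit_iff, reachableBit_iff] at h
    obtain ⟨⟨hinj, hne⟩, V, hV, hb⟩ := h
    exact ⟨D, hinj, hne, fun i => V i 0, fun i d => V i d.succ,
      fun i => ⟨(hV i).1 0, fun d => (hV i).1 d.succ, (hV i).2⟩, hb⟩
  · rintro ⟨D, hinj, hne, q, p, h, hb⟩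
    refine ⟨fun d => D d, fun d => by rw [numCandidates_encode]; exact (D d).2, ?_⟩
    rw [Bool.and_eq_true, distinctBit_iff, reachableBit_iff]
    refine ⟨⟨hinj, hne⟩, fun i => Fin.cons (q i) (p i), fun i => ⟨?_, ?_⟩, ?_⟩
    · exact Fin.cases (h i).1 (h i).2.1
    · simpa using (h i).2.2
    · simpa using hb

end Correctness

end RankVoting

theorem mainTheorem3 (k : ℕ) (hk : 1 ≤ k) (r : RankVoting.PositionalScoringRule)
    (hcomp : r.PolyTimeComputable) (hpoly : r.HasPolynomialScores) :
    Nonempty (Turing.TM2ComputableInPolyTime RankVoting.Instance.encode Computability.encodeBool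
      (RankVoting.Instance.maxRankExceeds r k)) := by
  obtain ⟨tm, inp, outp, h⟩ := RankVoting.exists_poly_clamped hcomp hpoly
  exact (RankVoting.poly_answer h k).nonempty_tm2 fun I => by
    rw [RankVoting.answer_encode]
    rfl
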